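/- Let $1<p<\infty$, $\lambda_1=p-1$ and $\lambda<\lambda_1$, and let $$\pi_p=2\int_0^1\frac{dt}{(1-t^p)^{1/p}}=\frac{2\pi}{p\sin(\pi/p)}.$$ Let $\sin_p$ be the inverse of $\arcsin_p x=\int_0^x(1-t^p)^{-1/p}\,dt$ ($0\le x\le 1$) on $[0,\pi_p/2]$, extended to $\mathbb R$ as an odd $2\pi_p$-periodic function with $\sin_p x=\sin_p(\pi_p-x)$, and put $\cos_p=(\sin_p)'$, $\cot_p=\cos_p/\sin_p$. Let $\sinh_p$ be the inverse of $\operatorname{arcsinh}_p x=\int_0^x(1+t^p)^{-1/p}\,dt$ ($x\ge 0$) on $[0,\infty)$, extended to $\mathbb R$ as an odd function, and put $\cosh_p=(\sinh_p)'$, $\coth_p=\cosh_p/\sinh_p$. For $r\in C[0,\pi_p]$ consider the problem $$\left(|u'|^{p-2}u'\right)'+(\lambda+r(x))|u|^{p-2}u=0\quad\text{in }(0,\pi_p),\qquad u(0)=u(\pi_p)=0,\qquad(\ast)$$ where a solution is a function $u\in W^{1,p}_0(0,\pi_p)$ that satisfies the equation in the sense of distributions. Put $r_+=\max(r,0)$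 and $$C(p,\lambda)=\begin{cases} 2\left(\frac{\lambda}{\lambda_1}\right)^{\frac{p-1}{p}}\left(\cot_p\left(\frac{\pi_p}{2}\left(\frac{\lambda}{\lambda_1}\right)^{1/p}\right)\right)^{p-1},&0<\lambda<\lambda_1,\\ \frac{2^p}{\pi_p^{p-1}},&\lambda=0,\\ 2\left(\frac{-\lambda}{\lambda_1}\right)^{\frac{p-1}{p}}\left(\coth_p\left(\frac{\pi_p}{2}\left(\frac{-\lambda}{\lambda_1}\right)^{1/p}\right)\right)^{p-1},&\lambda<0. \end{cases}$$ If $r\in C[0,\pi_p]$ and $(\ast)$ has a nontrivial solution, then $\|r_+\|_{L^1(0,\pi_p)}>C(p,\lambda)$. Moreover, this estimate is sharp: for every $\varepsilon>0$ there is $r\in C[0,\pi_p]$ for which $(\ast)$ has a nontrivial solution and $\left|\|r_+\|_{L^1(0,\pi_p)}-C(p,\lambda)\right|<\varepsilon$. -/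

import Mathlib

open MeasureTheory Set Filter Topology

noncomputable section

/-! ### Generalized trigonometric and hyperbolic functions -/

/-- `arcsin_p x = ∫_0^x (1 - t^p)^(-1/p) dt` for `0 ≤ x ≤ 1`. -/
def arcsinp (p x : ℝ) : ℝ := ∫ t in (0 : ℝ)..x, 1 / (1 - t ^ p) ^ (1 / p)

/-- `π_p = 2 arcsin_p 1 = 2 ∫_0^1 (1 - t^p)^(-1/p) dt`. -/
def pip (p : ℝ) : ℝ := 2 * arcsinp p 1

/-- The inverse of `arcsin_p : [0, 1] → [0, π_p / 2]`. -/
def sinpBase (p : ℝ) : ℝ → ℝ := Function.invFunOn (arcsinp p) (Icc 0 1)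

/-- The representative of `x` modulo `2 π_p` in `[-π_p, π_p)`. -/
def redp (p x : ℝ) : ℝ := x - 2 * pip p * (round (x / (2 * pip p)) : ℤ)

/-- `sin_p` on `ℝ`: the odd, `2 π_p`-periodic extension, with `sin_p x = sin_p (π_p - x)`, of the
inverse of `arcsin_p` on `[0, π_p / 2]`. -/
def sinp (p x : ℝ) : ℝ :=
  Real.sign (redp p x) * sinpBase p (min |redp p x| (pip p - |redp p x|))

/-- `cos_p` is the derivative of `sin_p`. -/
def cosp (p : ℝ) : ℝ → ℝ := deriv (sinp p)

/-- `cot_p = cos_p / sin_p`. -/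
def cotp (p x : ℝ) : ℝ := cosp p x / sinp p x

/-- `arcsinh_p x = ∫_0^x (1 + t^p)^(-1/p) dt` for `x ≥ 0`. -/
def arcsinhp (p x : ℝ) : ℝ := ∫ t in (0 : ℝ)..x, 1 / (1 + t ^ p) ^ (1 / p)

/-- `sinh_p` on `ℝ`: the odd extension of the inverse of `arcsinh_p` on `[0, ∞)`. -/
def sinhp (p x : ℝ) : ℝ := Real.sign x * Function.invFunOn (arcsinhp p) (Ici 0) |x|

/-- `cosh_p` is the derivative of `sinh_p`. -/
def coshp (p : ℝ) : ℝ → ℝ := deriv (sinhp p)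

/-- `coth_p = cosh_p / sinh_p`. -/
def cothp (p x : ℝ) : ℝ := coshp p x / sinhp p x

/-! ### Sobolev functions on an open subset of the line -/

/-- `g` is the weak derivative of `u` in `Ω`. -/
def IsWeakDeriv (Ω : TopologicalSpace.Opens ℝ) (u g : ℝ → ℝ) : Prop :=
  LocallyIntegrableOn u Ω ∧ LocallyIntegrableOn g Ω ∧
    ∀ φ : TestFunction Ω ℝ ⊤, ∫ x in (Ω : Set ℝ), u x * deriv φ x = -∫ x in (Ω : Set ℝ), g x * φ x

/-- `u ∈ W^{1,p}(Ω)`, with weak derivative `g`. -/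
def MemW1p (Ω : TopologicalSpace.Opens ℝ) (p : ℝ) (u g : ℝ → ℝ) : Prop :=
  MemLp u (ENNReal.ofReal p) (volume.restrict Ω) ∧
    MemLp g (ENNReal.ofReal p) (volume.restrict Ω) ∧ IsWeakDeriv Ω u g

/-- `u ∈ W^{1,p}_0(Ω)`, with weak derivative `g`: `u` lies in the closure of the test functions
for the norm of `W^{1,p}(Ω)`. -/
def MemW1pZero (Ω : TopologicalSpace.Opens ℝ) (p : ℝ) (u g : ℝ → ℝ) : Prop :=
  MemW1p Ω p u g ∧ ∃ φ : ℕ → TestFunction Ω ℝ ⊤,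
    Tendsto (fun n => eLpNorm (fun x => u x - φ n x) (ENNReal.ofReal p) (volume.restrict Ω))
      atTop (𝓝 0) ∧
    Tendsto (fun n => eLpNorm (fun x => g x - deriv (φ n) x) (ENNReal.ofReal p)
      (volume.restrict Ω)) atTop (𝓝 0)

/-! ### The Dirichlet problem -/

/-- The interval `(0, π_p)`. -/
def intervalp (p : ℝ) : TopologicalSpace.Opens ℝ := ⟨Ioo 0 (pip p), isOpen_Ioo⟩

/-- `u` is a solution of `(|u'|^(p-2) u')' + (lam + r) |u|^(p-2) u = 0` in `(0, π_p)`,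
`u(0) = u(π_p) = 0`: `u ∈ W^{1,p}_0(0, π_p)` and the equation holds in the sense of
distributions. -/
def IsSolution (p lam : ℝ) (r u : ℝ → ℝ) : Prop :=
  ∃ g : ℝ → ℝ, MemW1pZero (intervalp p) p u g ∧
    ∀ φ : TestFunction (intervalp p) ℝ ⊤,
      -(∫ x in Ioo 0 (pip p), |g x| ^ (p - 2) * g x * deriv φ x) +
        ∫ x in Ioo 0 (pip p), (lam + r x) * (|u x| ^ (p - 2) * u x) * φ x = 0

/-- The problem with potential `r` has a nontrivial solution. -/
def HasNontrivialSolution (p lam : ℝ) (r : ℝ → ℝ) : Prop :=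
  ∃ u : ℝ → ℝ, IsSolution p lam r u ∧ ¬ u =ᵐ[volume.restrict (Ioo 0 (pip p))] 0

/-- The `L^1(0, π_p)` norm of `r_+ = max (r, 0)`. -/
def normPosPart (p : ℝ) (r : ℝ → ℝ) : ℝ := ∫ x in Ioo 0 (pip p), max (r x) 0

/-- The constant `C(p, lam)`, for `lam < lam₁ = p - 1`. -/
def lyapunovConst (p lam : ℝ) : ℝ :=
  if 0 < lam then
    2 * (lam / (p - 1)) ^ ((p - 1) / p) *
      cotp p (pip p / 2 * (lam / (p - 1)) ^ (1 / p)) ^ (p - 1)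
  else if lam = 0 then
    2 ^ p / pip p ^ (p - 1)
  else
    2 * (-lam / (p - 1)) ^ ((p - 1) / p) *
      cothp p (pip p / 2 * (-lam / (p - 1)) ^ (1 / p)) ^ (p - 1)

end

noncomputable section

/-! ### The Riccati equation and Picone's inequality -/

/-! Write `L = pip p`. Both halves rest on a solution `W` of the Riccati equation `W' = -lam -
(p-1)|W|^(p/(p-1))` on `(0, L)`, the equation satisfied by `(s'/s)^(p-1)` when `s` is a positive
increasing solution of the problem with `r = 0` and `s 0 = 0`.

Lower bound. Young's inequality gives `(W|ψ|^p)' ≤ |ψ'|^p - lam|ψ|^p` (Picone). Integrating from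
both ends up to `b` gives `S b * |ψ b|^p ≤ E` with `S x = W x + W (L - x)` and `E` the energy of
`ψ`; this passes to `W^{1,p}_0` by density (`MemW1pZero.riccati_mul_le_energy`). For a solution `u`,
testing the equation with `u` gives `E = ∫ r|u|^p`, hence `E ≤ ∫ r₊|u|^p ≤ E ∫ r₊/S`. Nontriviality
forces `E > 0`, so `1 ≤ ∫ r₊/S`. Since `S` has its strict minimum `2 W(L/2)` at the midpoint
(`riccati_add_reflect_lt`), `‖r₊‖ > 2 W(L/2)`, strictly.

Sharpness. The extremal potential would be a point mass `2 W(L/2)` at the midpoint, where the even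
reflection of `s` has a corner. Rounding that corner by a cutoff of the flux `(s')^(p-1)` on `[a,
L/2]` produces a continuous potential, and `a → L/2` makes its norm approach the bound
(`IsHalfSolution.exists_potential`, `IsHalfSolution.exists_potential_lt`).

It remains to exhibit `s`: `sin_p(kx)`, `x` or `sinh_p(kx)` according to the sign of `lam`, so that
`2 W(L/2)` becomes `C(p, lam)`. The condition `lam < p - 1` puts the first critical point of
`sin_p(kx)` beyond the midpoint. -/

theorem rpow_mul_self_abs {p : ℝ} (hp : 1 < p) (y : ℝ) : |(|y| ^ (p - 2) * y)| = |y| ^ (p - 1) := by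
  rcases eq_or_ne y 0 with rfl | hy
  · simp [Real.zero_rpow (by linarith : p - 1 ≠ 0)]
  · have h : 0 < |y| := abs_pos.2 hy
    rw [abs_mul, abs_of_nonneg (Real.rpow_nonneg h.le _), ← Real.rpow_add_one h.ne']
    congr 1; ring

theorem rpow_mul_self_mul_self {p : ℝ} (hp : 1 < p) (y : ℝ) :
    |y| ^ (p - 2) * y * y = |y| ^ p := by
  rcases eq_or_ne y 0 with rfl | hy
  · simp [Real.zero_rpow (by linarith : p ≠ 0)]
  · have h : 0 < |y| := abs_pos.2 hy
    rw [mul_assoc, ← abs_mul_abs_self y, ← mul_assoc, ← Real.rpow_add_one h.ne',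
      ← Real.rpow_add_one h.ne']
    congr 1; ring

/-- Young's inequality with exponents `p` and `p/(p-1)`. With `w = W x`, `y = ψ x`, `z = ψ' x` it is
the pointwise form of Picone's inequality. -/
theorem young_rpow {p : ℝ} (hp : 1 < p) (w y z : ℝ) :
    p * w * (|y| ^ (p - 2) * y) * z ≤ |z| ^ p + (p - 1) * |w| ^ (p / (p - 1)) * |y| ^ p := by
  have hpq : p.HolderConjugate (p / (p - 1)) := Real.HolderConjugate.conjExponent hp
  have h := Real.young_inequality z (w * (|y| ^ (p - 2) * y)) hpq
  have h1 : |w * (|y| ^ (p - 2) * y)| ^ (p / (p - 1)) = |w| ^ (p / (p - 1)) * |y| ^ p := by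
    rw [abs_mul, rpow_mul_self_abs hp, Real.mul_rpow (abs_nonneg _) (by positivity),
      ← Real.rpow_mul (abs_nonneg _)]
    congr 2; field_simp [(by linarith : p - 1 ≠ 0)]
  rw [h1] at h
  have hp0 : 0 < p := by linarith
  have hp1 : 0 < p - 1 := by linarith
  have h2 := mul_le_mul_of_nonneg_left h hp0.le
  have h3 : p * (|z| ^ p / p + |w| ^ (p / (p - 1)) * |y| ^ p / (p / (p - 1)))
      = |z| ^ p + (p - 1) * |w| ^ (p / (p - 1)) * |y| ^ p := by
    field_simp
  rw [h3] at h2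
  linarith

/-- A solution of the Riccati equation bounds the energy of functions vanishing near `0`. -/
theorem riccati_mul_le_energy {p lam L : ℝ} (hp : 1 < p) {W : ℝ → ℝ}
    (hW : ∀ x ∈ Ioo 0 L, HasDerivAt W (-lam - (p - 1) * |W x| ^ (p / (p - 1))) x)
    {ψ : ℝ → ℝ} (hψ : ContDiff ℝ 1 ψ) (h0 : ∀ᶠ x in 𝓝 0, ψ x = 0) {b : ℝ} (hb : b ∈ Ioo 0 L) :
    W b * |ψ b| ^ p ≤ ∫ x in 0..b, (|deriv ψ x| ^ p - lam * |ψ x| ^ p) := by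
  have hp0 : 0 ≤ p := by linarith
  have hcd : Continuous (deriv ψ) := hψ.continuous_deriv le_rfl
  have hcont : Continuous fun x => |deriv ψ x| ^ p - lam * |ψ x| ^ p :=
    (hcd.abs.rpow_const fun _ => Or.inr hp0).sub
      (continuous_const.mul (hψ.continuous.abs.rpow_const fun _ => Or.inr hp0))
  obtain ⟨δ, hδ, hδ0⟩ := Metric.eventually_nhds_iff.1 h0
  -- `W` is controlled only on the open interval, so integration starts at a point `e > 0` at which
  -- `ψ` still vanishes.
  obtain ⟨e, he0, he⟩ := exists_between (lt_min hδ hb.1)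
  have heb : e < b := he.trans_le (min_le_right _ _)
  have hz : ∀ x ∈ Icc 0 e, ψ x = 0 := fun x hx => hδ0 (by
    rw [Real.dist_eq, sub_zero, abs_of_nonneg hx.1]
    exact hx.2.trans_lt (he.trans_le (min_le_left _ _)))
  have hderψ : ∀ x, HasDerivAt ψ (deriv ψ x) x := fun x =>
    (hψ.differentiable one_ne_zero x).hasDerivAt
  have hder : ∀ x ∈ Ioo 0 L, HasDerivAt (fun x => W x * |ψ x| ^ p)
      ((-lam - (p - 1) * |W x| ^ (p / (p - 1))) * |ψ x| ^ p
        + W x * (p * |ψ x| ^ (p - 2) * ψ x * deriv ψ x)) x := fun x hx =>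
    (hW x hx).mul ((hasDerivAt_abs_rpow (ψ x) hp).comp x (hderψ x))
  have key := intervalIntegral.sub_le_integral_of_hasDeriv_right_of_le
    (g := fun x => W x * |ψ x| ^ p) (φ := fun x => |deriv ψ x| ^ p - lam * |ψ x| ^ p) heb.le
    (fun x hx => (hder x ⟨he0.trans_le hx.1, hx.2.trans_lt hb.2⟩).continuousAt.continuousWithinAt)
    (fun x hx => (hder x ⟨he0.trans hx.1, hx.2.trans hb.2⟩).hasDerivWithinAt)
    (hcont.integrableOn_Icc) (fun x hx => by
      have := young_rpow hp (W x) (ψ x) (deriv ψ x)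
      nlinarith [this])
  have hsplit := intervalIntegral.integral_add_adjacent_intervals
    (hcont.intervalIntegrable (μ := volume) 0 e) (hcont.intervalIntegrable e b)
  have hzero : ∫ x in 0..e, (|deriv ψ x| ^ p - lam * |ψ x| ^ p) = 0 := by
    rw [intervalIntegral.integral_of_le he0.le, integral_Ioc_eq_integral_Ioo]
    refine setIntegral_eq_zero_of_forall_eq_zero fun x hx => ?_
    have hd : deriv ψ x = 0 := by
      have : ψ =ᶠ[𝓝 x] fun _ => 0 := by
        filter_upwards [Ioo_mem_nhds hx.1 hx.2] with y hy using hz y ⟨hy.1.le, hy.2.le⟩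
      rw [this.deriv_eq]; simp
    simp [hd, hz x ⟨hx.1.le, hx.2.le⟩, Real.zero_rpow (by linarith : p ≠ 0)]
  simp only [hz e ⟨he0.le, le_rfl⟩, abs_zero, Real.zero_rpow (by linarith : p ≠ 0), mul_zero,
    sub_zero] at key
  linarith

/-- The one-sided bound is applied to `ψ` on `[0, b]` and to its reflection on `[0, L - b]`; the two
energies add up to that of the whole interval. -/
theorem riccati_add_reflect_mul_le_energy {p lam L : ℝ} (hp : 1 < p) {W : ℝ → ℝ}
    (hW : ∀ x ∈ Ioo 0 L, HasDerivAt W (-lam - (p - 1) * |W x| ^ (p / (p - 1))) x)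
    {ψ : ℝ → ℝ} (hψ : ContDiff ℝ 1 ψ) (h0 : ∀ᶠ x in 𝓝 0, ψ x = 0) (hL : ∀ᶠ x in 𝓝 L, ψ x = 0)
    {b : ℝ} (hb : b ∈ Ioo 0 L) :
    (W b + W (L - b)) * |ψ b| ^ p ≤ ∫ x in 0..L, (|deriv ψ x| ^ p - lam * |ψ x| ^ p) := by
  have hp0 : 0 ≤ p := by linarith
  have hcd : Continuous (deriv ψ) := hψ.continuous_deriv le_rfl
  have hcont : Continuous fun x => |deriv ψ x| ^ p - lam * |ψ x| ^ p :=
    (hcd.abs.rpow_const fun _ => Or.inr hp0).sub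
      (continuous_const.mul (hψ.continuous.abs.rpow_const fun _ => Or.inr hp0))
  have h1 := riccati_mul_le_energy hp hW hψ h0 hb
  have hψ' : ContDiff ℝ 1 fun x => ψ (L - x) := hψ.comp (contDiff_const.sub contDiff_id)
  have h0' : ∀ᶠ x in 𝓝 (0 : ℝ), ψ (L - x) = 0 := by
    have : Tendsto (fun x : ℝ => L - x) (𝓝 0) (𝓝 L) := by
      have : ContinuousAt (fun x : ℝ => L - x) 0 := by fun_prop
      simpa [ContinuousAt] using this
    exact this.eventually hL
  have h2 := riccati_mul_le_energy hp hW hψ' h0'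
    (b := L - b) ⟨by linarith [hb.2], by linarith [hb.1]⟩
  have hd : ∀ x, deriv (fun x => ψ (L - x)) x = -deriv ψ (L - x) := fun x =>
    deriv_comp_const_sub ψ L x
  simp only [hd, abs_neg, sub_sub_cancel] at h2
  rw [intervalIntegral.integral_comp_sub_left
    (fun x => |deriv ψ x| ^ p - lam * |ψ x| ^ p) L] at h2
  simp only [sub_sub_cancel, sub_zero] at h2
  rw [← intervalIntegral.integral_add_adjacent_intervals
    (hcont.intervalIntegrable (μ := volume) 0 b) (hcont.intervalIntegrable b L)]
  linarith

/-- A decreasing Riccati solution that is positive at `L / 2`: the function `W x + W (L - x)` has a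
strict minimum at `L / 2`. -/
theorem riccati_add_reflect_lt_of_lt {p lam L : ℝ} (hp : 1 < p) {W : ℝ → ℝ}
    (hW : ∀ x ∈ Ioo 0 L, HasDerivAt W (-lam - (p - 1) * |W x| ^ (p / (p - 1))) x)
    (hneg : ∀ x ∈ Ioo 0 L, -lam - (p - 1) * |W x| ^ (p / (p - 1)) < 0)
    (hpos : 0 < W (L / 2)) {x : ℝ} (hx : 0 < x) (hxm : x < L / 2) :
    2 * W (L / 2) < W x + W (L - x) := by
  have hanti : StrictAntiOn W (Ioo 0 L) := by
    refine strictAntiOn_of_deriv_neg (convex_Ioo _ _)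
      (fun y hy => (hW y hy).continuousAt.continuousWithinAt) fun y hy => ?_
    rw [interior_Ioo] at hy
    rw [(hW y hy).deriv]; exact hneg y hy
  set S : ℝ → ℝ := fun y => W y + W (L - y) with hS
  have hSd : ∀ y ∈ Ioo 0 L, HasDerivAt S
      ((p - 1) * (|W (L - y)| ^ (p / (p - 1)) - |W y| ^ (p / (p - 1)))) y := by
    intro y hy
    have h1 := hW (L - y) ⟨by linarith [hy.2], by linarith [hy.1]⟩
    have h2 := (hW y hy).add (h1.comp y ((hasDerivAt_id y).const_sub L))
    exact h2.congr_deriv (by ring)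
  have hSm : S (L / 2) = 2 * W (L / 2) := by
    simp only [hS]; rw [show L - L / 2 = L / 2 by ring]; ring
  have hSc : ContinuousOn S (Ioo 0 L) := fun y hy => (hSd y hy).continuousAt.continuousWithinAt
  have hSm0 : 0 < S (L / 2) := by rw [hSm]; linarith
  -- `W (L - y)` may be negative. Monotonicity gives `W (L - y) < W y`, and `S y > 0` gives `-W y <
  -- W (L - y)`; together they compare the absolute values.
  have hdneg : ∀ y, 0 < y → y < L / 2 → 0 < S y →
      (p - 1) * (|W (L - y)| ^ (p / (p - 1)) - |W y| ^ (p / (p - 1))) < 0 := by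
    intro y hy hym hSy
    have hlt : W (L - y) < W y :=
      hanti ⟨hy, by linarith⟩ ⟨by linarith, by linarith⟩ (by linarith)
    have hSy' : 0 < W y + W (L - y) := hSy
    have hle : |W (L - y)| < |W y| := by
      rw [abs_of_nonneg (by linarith : 0 ≤ W y)]
      exact abs_lt.2 ⟨by linarith, hlt⟩
    have h1 : 0 < p - 1 := by linarith
    have h2 : 0 < p / (p - 1) := div_pos (by linarith) h1
    have := Real.rpow_lt_rpow (abs_nonneg _) hle h2
    exact mul_neg_of_pos_of_neg h1 (by linarith)
  have hsub : ∀ z, 0 < z → Icc z (L / 2) ⊆ Ioo 0 L := fun z hz y hy =>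
    ⟨hz.trans_le hy.1, by linarith [hy.2]⟩
  have hmono : ∀ z, 0 < z → (∀ y ∈ Ioo z (L / 2), 0 < S y) → StrictAntiOn S (Icc z (L / 2)) := by
    intro z hz h
    refine strictAntiOn_of_deriv_neg (convex_Icc _ _) (hSc.mono (hsub z hz)) fun y hy => ?_
    rw [interior_Icc] at hy
    rw [(hSd y (hsub z hz (Ioo_subset_Icc_self hy))).deriv]
    exact hdneg y (hz.trans hy.1) hy.2 (h y hy)
  -- Positivity of `S` is bootstrapped from the midpoint: at the last `z` with `S z ≤ S (L/2) / 2`,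
  -- `S` is positive to the right of `z`, hence decreasing on `[z, L/2]`, so `S z > S (L/2)`, a
  -- contradiction.
  have hall : ∀ y ∈ Icc x (L / 2), S (L / 2) / 2 < S y := by
    by_contra! hcon
    obtain ⟨y, hy, hyS⟩ := hcon
    have hK : IsCompact (Icc x (L / 2) ∩ S ⁻¹' Iic (S (L / 2) / 2)) :=
      isCompact_Icc.of_isClosed_subset
        ((hSc.mono (hsub x hx)).preimage_isClosed_of_isClosed isClosed_Icc isClosed_Iic)
        inter_subset_left
    obtain ⟨z, ⟨hz, hzS⟩, hzmax⟩ := hK.exists_isGreatest ⟨y, hy, hyS⟩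
    have hzS' : S z ≤ S (L / 2) / 2 := hzS
    have hz0 : 0 < z := hx.trans_le hz.1
    have hzm : z < L / 2 := lt_of_le_of_ne hz.2 (by rintro rfl; linarith)
    have := hmono z hz0 (fun w hw => by
      by_contra! hcon
      exact absurd (hzmax ⟨⟨hz.1.trans hw.1.le, hw.2.le⟩, (by linarith : S w ≤ S (L / 2) / 2)⟩)
        (not_le.2 hw.1)) (left_mem_Icc.2 hzm.le) (right_mem_Icc.2 hzm.le) hzm
    linarith
  have := hmono x hx (fun y hy => by linarith [hall y (Ioo_subset_Icc_self hy)])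
    (left_mem_Icc.2 hxm.le) (right_mem_Icc.2 hxm.le) hxm
  rw [hSm] at this
  exact this

theorem riccati_add_reflect_lt {p lam L : ℝ} (hp : 1 < p) {W : ℝ → ℝ}
    (hW : ∀ x ∈ Ioo 0 L, HasDerivAt W (-lam - (p - 1) * |W x| ^ (p / (p - 1))) x)
    (hneg : ∀ x ∈ Ioo 0 L, -lam - (p - 1) * |W x| ^ (p / (p - 1)) < 0)
    (hpos : 0 < W (L / 2)) {x : ℝ} (hx : x ∈ Ioo 0 L) (hxm : x ≠ L / 2) :
    2 * W (L / 2) < W x + W (L - x) := by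
  rcases lt_or_gt_of_ne hxm with h | h
  · exact riccati_add_reflect_lt_of_lt hp hW hneg hpos hx.1 h
  · have := riccati_add_reflect_lt_of_lt hp hW hneg hpos (x := L - x)
      (by linarith [hx.2]) (by linarith)
    rwa [sub_sub_cancel, add_comm] at this

/-! ### The lower bound -/

section Lp

variable {α : Type*} {mα : MeasurableSpace α} {μ : Measure α}

/-- By Hölder, pairing with a fixed `L^q` function is continuous on `L^p`. -/
theorem tendsto_integral_mul_of_tendsto_eLpNorm {p q : ℝ} (hpq : q.HolderConjugate p)
    {f h : α → ℝ} {F : ℕ → α → ℝ} (hf : MemLp f (ENNReal.ofReal q) μ)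
    (hh : MemLp h (ENNReal.ofReal p) μ) (hF : ∀ n, MemLp (F n) (ENNReal.ofReal p) μ)
    (hlim : Tendsto (fun n => eLpNorm (fun x => h x - F n x) (ENNReal.ofReal p) μ) atTop (𝓝 0)) :
    Tendsto (fun n => ∫ x, f x * F n x ∂μ) atTop (𝓝 (∫ x, f x * h x ∂μ)) := by
  have : ENNReal.HolderTriple (ENNReal.ofReal q) (ENNReal.ofReal p) 1 := hpq.ennrealOfReal
  refine tendsto_integral_of_L1' _ (hf.1.mul hh.1)
    (Eventually.of_forall fun n => hf.integrable_mul (hF n)) ?_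
  have hb : ∀ n, eLpNorm ((fun x => f x * F n x) - fun x => f x * h x) 1 μ ≤
      eLpNorm f (ENNReal.ofReal q) μ
        * eLpNorm (fun x => h x - F n x) (ENNReal.ofReal p) μ := by
    intro n
    have : ((fun x => f x * F n x) - fun x => f x * h x) = -(f • fun x => h x - F n x) := by
      ext x; simp; ring
    rw [this, eLpNorm_neg]
    exact eLpNorm_smul_le_mul_eLpNorm (hh.1.sub (hF n).1) hf.1
  refine tendsto_of_tendsto_of_tendsto_of_le_of_le tendsto_const_nhds ?_ (fun _ => zero_le) hb
  simpa using ENNReal.Tendsto.const_mul hlim (Or.inr hf.eLpNorm_ne_top)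

theorem tendsto_integral_rpow_of_tendsto_eLpNorm {p : ℝ} (hp : 1 < p)
    {h : α → ℝ} {F : ℕ → α → ℝ}
    (hh : MemLp h (ENNReal.ofReal p) μ) (hF : ∀ n, MemLp (F n) (ENNReal.ofReal p) μ)
    (hlim : Tendsto (fun n => eLpNorm (fun x => h x - F n x) (ENNReal.ofReal p) μ) atTop (𝓝 0)) :
    Tendsto (fun n => ∫ x, |F n x| ^ p ∂μ) atTop (𝓝 (∫ x, |h x| ^ p ∂μ)) := by
  have hp0 : 0 < p := by linarith
  have : Fact (1 ≤ ENNReal.ofReal p) := ⟨by simpa using ENNReal.ofReal_le_ofReal hp.le⟩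
  have hl : Tendsto (fun n => (hF n).toLp) atTop (𝓝 hh.toLp) := by
    rw [Lp.tendsto_Lp_iff_tendsto_eLpNorm'']
    refine hlim.congr fun n => ?_
    rw [← eLpNorm_neg]; congr 1; ext x; simp
  have hn := hl.norm
  simp only [Lp.norm_toLp] at hn
  have hint : ∀ k : α → ℝ, MemLp k (ENNReal.ofReal p) μ →
      ∫ x, |k x| ^ p ∂μ = (eLpNorm k (ENNReal.ofReal p) μ).toReal ^ p := by
    intro k hk
    have h0 : 0 ≤ ∫ x, |k x| ^ p ∂μ := integral_nonneg fun x => by positivity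
    rw [hk.eLpNorm_eq_integral_rpow_norm (by simpa using hp0) ENNReal.ofReal_ne_top,
      ENNReal.toReal_ofReal hp0.le]
    simp only [Real.norm_eq_abs]
    rw [ENNReal.toReal_ofReal (by positivity), Real.rpow_inv_rpow h0 hp0.ne']
  rw [hint h hh]
  refine ((hn.rpow_const (Or.inr hp0.le))).congr fun n => (hint _ (hF n)).symm

/-- The absolute value is `|f|^(p-1)`. This puts both the flux and the nonlinear term in the
exponent dual to `p`. -/
theorem MemLp.rpow_mul_self {p : ℝ} (hp : 1 < p) {f : α → ℝ} (hf : MemLp f (ENNReal.ofReal p) μ) :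
    MemLp (fun x => |f x| ^ (p - 2) * f x) (ENNReal.ofReal (p / (p - 1))) μ := by
  have hp1 : 0 < p - 1 := by linarith
  have h := hf.norm_rpow_div (ENNReal.ofReal (p - 1))
  rw [ENNReal.toReal_ofReal hp1.le, ← ENNReal.ofReal_div_of_pos hp1] at h
  refine h.mono ?_ (Eventually.of_forall fun x => ?_)
  · exact ((hf.1.aemeasurable.abs.pow_const _).mul hf.1.aemeasurable).aestronglyMeasurable
  · rw [Real.norm_eq_abs, rpow_mul_self_abs hp, Real.norm_eq_abs, Real.norm_eq_abs,
      abs_of_nonneg (by positivity : 0 ≤ |f x| ^ (p - 1))]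

end Lp

variable {Ω : TopologicalSpace.Opens ℝ}

theorem TestFunction.continuous_deriv (φ : TestFunction Ω ℝ ⊤) : Continuous (deriv φ) :=
  (φ.contDiff.of_le (by exact_mod_cast le_top : (1 : WithTop ℕ∞) ≤ _)).continuous_deriv le_rfl

theorem TestFunction.memLp (φ : TestFunction Ω ℝ ⊤) (q : ENNReal) (μ : Measure ℝ)
    [IsFiniteMeasureOnCompacts μ] : MemLp φ q μ :=
  φ.continuous.memLp_of_hasCompactSupport φ.hasCompactSupport

theorem TestFunction.memLp_deriv (φ : TestFunction Ω ℝ ⊤) (q : ENNReal) (μ : Measure ℝ)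
    [IsFiniteMeasureOnCompacts μ] : MemLp (deriv φ) q μ :=
  φ.continuous_deriv.memLp_of_hasCompactSupport φ.hasCompactSupport.deriv

theorem ContinuousOn.memLp_top_Ioo {f : ℝ → ℝ} {a b : ℝ} (hf : ContinuousOn f (Icc a b)) :
    MemLp f ⊤ (volume.restrict (Ioo a b)) := by
  obtain ⟨C, hC⟩ := isCompact_Icc.exists_bound_of_continuousOn hf
  refine memLp_top_of_bound ((hf.mono Ioo_subset_Icc_self).aestronglyMeasurable measurableSet_Ioo) C
    ?_
  filter_upwards [ae_restrict_mem measurableSet_Ioo] with x hx using hC x (Ioo_subset_Icc_self hx)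

/-- Testing the equation with the solution itself. -/
theorem IsSolution.energy_eq {p lam : ℝ} (hp : 1 < p) {r u g : ℝ → ℝ}
    (hr : ContinuousOn r (Icc 0 (pip p))) (hu : MemW1pZero (intervalp p) p u g)
    (heq : ∀ φ : TestFunction (intervalp p) ℝ ⊤,
      -(∫ x in Ioo 0 (pip p), |g x| ^ (p - 2) * g x * deriv φ x) +
        ∫ x in Ioo 0 (pip p), (lam + r x) * (|u x| ^ (p - 2) * u x) * φ x = 0) :
    ∫ x in Ioo 0 (pip p), |g x| ^ p = ∫ x in Ioo 0 (pip p), (lam + r x) * |u x| ^ p := by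
  obtain ⟨⟨hu1, hg1, -⟩, φ, hφu, hφg⟩ := hu
  have hpq : (p / (p - 1)).HolderConjugate p := (Real.HolderConjugate.conjExponent hp).symm
  -- The solution is not itself a test function; the equation is tested with its approximants `φ n`,
  -- and both pairings pass to the limit.
  have h1 := tendsto_integral_mul_of_tendsto_eLpNorm hpq (MemLp.rpow_mul_self hp hg1) hg1
    (fun n => (φ n).memLp_deriv _ _) hφg
  have hb : MemLp (fun x => (lam + r x) * (|u x| ^ (p - 2) * u x)) (ENNReal.ofReal (p / (p - 1)))
      (volume.restrict (intervalp p)) :=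
    (MemLp.rpow_mul_self hp hu1).mul (p := ⊤) (continuousOn_const.add hr).memLp_top_Ioo
  have h2 := tendsto_integral_mul_of_tendsto_eLpNorm hpq hb hu1 (fun n => (φ n).memLp _ _) hφu
  have h3 := h1.neg.add h2
  have h4 : (fun n => -(∫ x in (intervalp p : Set ℝ), |g x| ^ (p - 2) * g x * deriv (φ n) x) +
      ∫ x in (intervalp p : Set ℝ), (lam + r x) * (|u x| ^ (p - 2) * u x) * φ n x) = fun _ => 0 :=
    funext fun n => heq (φ n)
  rw [h4] at h3
  have h5 := tendsto_nhds_unique h3 tendsto_const_nhds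
  simp only [mul_assoc ((lam : ℝ) + _)] at h5
  simp only [rpow_mul_self_mul_self hp] at h5
  have h6 : (intervalp p : Set ℝ) = Ioo 0 (pip p) := rfl
  rw [h6] at h5
  linarith

/-- The energy is continuous for the `W^{1,p}` norm, and a subsequence of the approximating test
functions converges almost everywhere. No continuous representative of `u` is needed. -/
theorem MemW1pZero.riccati_mul_le_energy {p lam : ℝ} (hp : 1 < p) (hL : 0 < pip p) {W : ℝ → ℝ}
    (hW : ∀ x ∈ Ioo 0 (pip p), HasDerivAt W (-lam - (p - 1) * |W x| ^ (p / (p - 1))) x)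
    {u g : ℝ → ℝ} (hu : MemW1pZero (intervalp p) p u g) :
    ∀ᵐ x ∂(volume.restrict (Ioo 0 (pip p))), (W x + W (pip p - x)) * |u x| ^ p ≤
      (∫ x in Ioo 0 (pip p), |g x| ^ p) - lam * ∫ x in Ioo 0 (pip p), |u x| ^ p := by
  obtain ⟨⟨hu1, hg1, -⟩, φ, hφu, hφg⟩ := hu
  have hp0 : 0 < p := by linarith
  have h1 := tendsto_integral_rpow_of_tendsto_eLpNorm hp hg1 (fun n => (φ n).memLp_deriv _ _) hφg
  have h2 := tendsto_integral_rpow_of_tendsto_eLpNorm hp hu1 (fun n => (φ n).memLp _ _) hφu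
  have hm := tendstoInMeasure_of_tendsto_eLpNorm (p := ENNReal.ofReal p) (by simpa using hp0)
    (fun n => ((φ n).memLp (ENNReal.ofReal p) (volume.restrict (intervalp p : Set ℝ))).1) hu1.1
    (hφu.congr fun n => by rw [← eLpNorm_neg]; congr 1; ext x; simp)
  obtain ⟨ns, hns, hae⟩ := hm.exists_seq_tendsto_ae
  have hE := (h1.sub (h2.const_mul lam)).comp hns.tendsto_atTop
  filter_upwards [hae, ae_restrict_mem measurableSet_Ioo] with x hx hxI
  refine le_of_tendsto_of_tendsto' ((hx.abs.rpow_const (Or.inr hp0.le)).const_mul _) hE fun n => ?_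
  set ψ := φ (ns n)
  have hev : ∀ y, y ∉ Ioo 0 (pip p) → ∀ᶠ x in 𝓝 y, ψ x = 0 := fun y hy =>
    notMem_tsupport_iff_eventuallyEq.1 fun h => hy (ψ.tsupport_subset h)
  have hint := fun f : ℝ → ℝ => integral_Ioc_eq_integral_Ioo (μ := volume) (f := f) (x := 0)
    (y := pip p)
  have := riccati_add_reflect_mul_le_energy hp hW
    (ψ.contDiff.of_le (by exact_mod_cast le_top : (1 : WithTop ℕ∞) ≤ _))
    (hev 0 (by simp)) (hev _ (by simp)) hxI
  refine this.trans (le_of_eq ?_)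
  have hi1 : Integrable (fun x => |deriv ψ x| ^ p) (volume.restrict (Ioo 0 (pip p))) :=
    ((ψ.continuous_deriv.abs.rpow_const fun _ => Or.inr hp0.le).integrableOn_Icc).mono_set
      Ioo_subset_Icc_self
  have hi2 : Integrable (fun x => |ψ x| ^ p) (volume.restrict (Ioo 0 (pip p))) :=
    ((ψ.continuous.abs.rpow_const fun _ => Or.inr hp0.le).integrableOn_Icc).mono_set
      Ioo_subset_Icc_self
  rw [intervalIntegral.integral_of_le hL.le, hint, integral_sub hi1 (hi2.const_mul lam),
    integral_const_mul]
  rfl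

/-- The pointwise bound `|u|^p ≤ E / S` is inserted into `E = ∫ r|u|^p`, and `E` cancels. -/
theorem two_mul_riccati_lt_normPosPart {p lam : ℝ} (hp : 1 < p) (hL : 0 < pip p) {W : ℝ → ℝ}
    (hW : ∀ x ∈ Ioo 0 (pip p), HasDerivAt W (-lam - (p - 1) * |W x| ^ (p / (p - 1))) x)
    (hneg : ∀ x ∈ Ioo 0 (pip p), -lam - (p - 1) * |W x| ^ (p / (p - 1)) < 0)
    (hpos : 0 < W (pip p / 2)) {r : ℝ → ℝ} (hr : ContinuousOn r (Icc 0 (pip p)))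
    (h : HasNontrivialSolution p lam r) : 2 * W (pip p / 2) < normPosPart p r := by
  obtain ⟨u, ⟨g, hu, heq⟩, hu0⟩ := h
  set μ := volume.restrict (Ioo 0 (pip p)) with hμ
  have hp0 : 0 < p := by linarith
  have hE1 := IsSolution.energy_eq hp hr hu heq
  have hE2 := hu.riccati_mul_le_energy hp hL hW
  have hup : Integrable (fun x => |u x| ^ p) μ := by
    have := hu.1.1.integrable_norm_rpow (by simpa using hp0) ENNReal.ofReal_ne_top
    rwa [ENNReal.toReal_ofReal hp0.le] at this
  have hrm : MemLp r ⊤ μ := hr.memLp_top_Ioo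
  have hrup : Integrable (fun x => r x * |u x| ^ p) μ := hrm.integrable_mul
    (memLp_one_iff_integrable.2 hup)
  have hE3 : (∫ x in Ioo 0 (pip p), |g x| ^ p) - lam * ∫ x in Ioo 0 (pip p), |u x| ^ p
      = ∫ x, r x * |u x| ^ p ∂μ := by
    rw [hE1]
    simp only [add_mul]
    rw [integral_add (hup.const_mul lam) hrup, integral_const_mul]
    ring
  rw [hE3] at hE2
  set E := ∫ x, r x * |u x| ^ p ∂μ with hE
  set S : ℝ → ℝ := fun x => W x + W (pip p - x) with hS
  set c := 2 * W (pip p / 2) with hc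
  have hc0 : 0 < c := by positivity
  have hSc : ∀ᵐ x ∂μ, c < S x := by
    have : ∀ᵐ x ∂μ, x ≠ pip p / 2 := ae_restrict_of_ae (Measure.ae_ne volume _)
    filter_upwards [this, ae_restrict_mem measurableSet_Ioo] with x hx hxI
    exact riccati_add_reflect_lt hp hW hneg hpos hxI hx
  have hE0 : 0 < E := by
    by_contra! hcon
    refine hu0 ?_
    filter_upwards [hE2, hSc] with x h1 h2
    have h3 : 0 < S x := hc0.trans h2
    have h4 : |u x| ^ p ≤ 0 := by
      by_contra! h5
      have := mul_pos h3 h5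
      simp only [hS] at this
      linarith
    have h5 : |u x| ^ p = 0 := le_antisymm h4 (by positivity)
    rw [Real.rpow_eq_zero (abs_nonneg _) hp0.ne', abs_eq_zero] at h5
    exact h5
  have hSco : ContinuousOn S (Ioo 0 (pip p)) := fun y hy =>
    ((hW y hy).continuousAt.add ((hW (pip p - y) ⟨by linarith [hy.2], by linarith [hy.1]⟩
      ).continuousAt.comp (by fun_prop : ContinuousAt (fun y => pip p - y) y))).continuousWithinAt
  have hrp : MemLp (fun x => max (r x) 0) ⊤ μ :=
    ContinuousOn.memLp_top_Ioo (hr.sup continuousOn_const)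
  have hrpi : Integrable (fun x => max (r x) 0) μ := hrp.integrable le_top
  have hSm : AEStronglyMeasurable S μ := hSco.aestronglyMeasurable measurableSet_Ioo
  have hquot : Integrable (fun x => max (r x) 0 / S x) μ := by
    refine (hrpi.div_const c).mono (hrp.1.aemeasurable.div hSm.aemeasurable).aestronglyMeasurable ?_
    filter_upwards [hSc] with x hx
    have h1 : 0 ≤ max (r x) 0 := le_max_right _ _
    rw [Real.norm_of_nonneg (div_nonneg h1 (hc0.trans hx).le),
      Real.norm_of_nonneg (div_nonneg h1 hc0.le)]
    exact div_le_div_of_nonneg_left h1 hc0 hx.le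
  have hone : 1 ≤ ∫ x, max (r x) 0 / S x ∂μ := by
    have hle : E ≤ ∫ x, E * (max (r x) 0 / S x) ∂μ := by
      refine integral_mono_ae hrup (hquot.const_mul E) ?_
      filter_upwards [hE2, hSc] with x h1 h2
      have h3 : 0 < S x := hc0.trans h2
      have h4 : |u x| ^ p ≤ E / S x := by
        rw [le_div_iff₀ h3, mul_comm]; exact h1
      calc r x * |u x| ^ p ≤ max (r x) 0 * |u x| ^ p := by gcongr; exact le_max_left _ _
        _ ≤ max (r x) 0 * (E / S x) := by gcongr
        _ = E * (max (r x) 0 / S x) := by ring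
    rw [integral_const_mul] at hle
    by_contra! hcon
    nlinarith
  -- Equality would force `r₊ = 0` almost everywhere, because `S > c` off the midpoint; then the
  -- left side would be `0`, not at least `1`.
  have hlt : ∫ x, max (r x) 0 / S x ∂μ < ∫ x, max (r x) 0 / c ∂μ := by
    have hle : (fun x => max (r x) 0 / S x) ≤ᵐ[μ] fun x => max (r x) 0 / c := by
      filter_upwards [hSc] with x hx
      exact div_le_div_of_nonneg_left (le_max_right _ _) hc0 hx.le
    refine lt_of_le_of_ne (integral_mono_ae hquot (hrpi.div_const c) hle) fun heq' => ?_
    have hae := (integral_eq_iff_of_ae_le hquot (hrpi.div_const c) hle).1 heq'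
    have hz : ∫ x, max (r x) 0 / S x ∂μ = 0 := by
      rw [← integral_zero ℝ ℝ (μ := μ)]
      refine integral_congr_ae ?_
      filter_upwards [hae, hSc] with x h1 h2
      have h3 : 0 < S x := hc0.trans h2
      rw [div_eq_div_iff h3.ne' hc0.ne'] at h1
      have : max (r x) 0 = 0 := by
        have h4 : max (r x) 0 * (S x - c) = 0 := by linarith
        exact (mul_eq_zero.1 h4).resolve_right (by linarith)
      simp [this]
    linarith
  rw [integral_div] at hlt
  have := hone.trans_lt hlt
  rwa [lt_div_iff₀ hc0, one_mul] at this

/-! ### Primitives of continuous functions in `W^{1,p}_0` -/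

theorem tendsto_eLpNorm_zero_of_bounded {α : Type*} {mα : MeasurableSpace α} {μ : Measure α}
    [IsFiniteMeasure μ] {p : ℝ} (hp : 0 < p) {F : ℕ → α → ℝ} {K : ℝ}
    (hF : ∀ n, AEStronglyMeasurable (F n) μ) (hK : ∀ n, ∀ᵐ x ∂μ, |F n x| ≤ K)
    (hlim : ∀ᵐ x ∂μ, Tendsto (fun n => F n x) atTop (𝓝 0)) :
    Tendsto (fun n => eLpNorm (F n) (ENNReal.ofReal p) μ) atTop (𝓝 0) := by
  have hmem : ∀ n, MemLp (F n) (ENNReal.ofReal p) μ := fun n => MemLp.of_bound (hF n) K (hK n)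
  have h1 : Tendsto (fun n => ∫ x, |F n x| ^ p ∂μ) atTop (𝓝 (∫ _, 0 ∂μ)) := by
    refine tendsto_integral_of_dominated_convergence (fun _ => K ^ p)
      (fun n => ((hF n).aemeasurable.abs.pow_const p).aestronglyMeasurable)
      (integrable_const _) (fun n => ?_) ?_
    · filter_upwards [hK n] with x hx
      rw [Real.norm_of_nonneg (by positivity)]
      exact Real.rpow_le_rpow (abs_nonneg _) hx hp.le
    · filter_upwards [hlim] with x hx
      have := (hx.abs.rpow_const (p := p) (Or.inr hp.le))
      simpa [Real.zero_rpow hp.ne'] using this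
  have h2 := ENNReal.tendsto_ofReal (h1.rpow_const (p := p⁻¹) (Or.inr (inv_nonneg.2 hp.le)))
  simp only [integral_zero, Real.zero_rpow (inv_ne_zero hp.ne'), ENNReal.ofReal_zero] at h2
  refine h2.congr fun n => ?_
  rw [(hmem n).eLpNorm_eq_integral_rpow_norm (by simpa using hp) ENNReal.ofReal_ne_top,
    ENNReal.toReal_ofReal hp.le]
  simp only [Real.norm_eq_abs]

/-- `G` is cut off near the endpoints, then approximated uniformly by smooth functions without
enlarging the support. -/
theorem exists_contDiff_tendsto_of_continuous {L : ℝ} {G : ℝ → ℝ} (hG : Continuous G) :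
    ∃ (γ : ℕ → ℝ → ℝ) (a : ℕ → ℝ) (K : ℝ), (∀ n, ContDiff ℝ (⊤ : ℕ∞) (γ n)) ∧ (∀ n, 0 < a n) ∧
      (∀ n x, x ∉ Icc (a n) (L - a n) → γ n x = 0) ∧ (∀ n, ∀ x ∈ Icc 0 L, |γ n x| ≤ K) ∧
      ∀ x ∈ Ioo 0 L, Tendsto (fun n => γ n x) atTop (𝓝 (G x)) := by
  obtain ⟨K, hK⟩ := isCompact_Icc.exists_bound_of_continuousOn (s := Icc 0 L) hG.continuousOn
  -- This cutoff is `0` within `1/(n+1)` of the endpoints and `1` at distance at least `2/(n+1)`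
  -- from them.
  set χ : ℕ → ℝ → ℝ := fun n x => max 0 (min 1 ((n + 1 : ℝ) * min x (L - x) - 1)) with hχ
  have hχ0 : ∀ n x, 0 ≤ χ n x := fun n x => le_max_left _ _
  have hχ1 : ∀ n x, χ n x ≤ 1 := fun n x => max_le zero_le_one (min_le_left _ _)
  have hχc : ∀ n, Continuous (χ n) := fun n => by fun_prop
  have happ : ∀ n : ℕ, ∃ g : ℝ → ℝ, ContDiff ℝ (⊤ : ℕ∞) g ∧
      (∀ x, dist (g x) (G x * χ n x) < 1 / (n + 1 : ℝ)) ∧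
      Function.support g ⊆ Function.support fun x => G x * χ n x := fun n =>
    (hG.mul (hχc n)).exists_contDiff_approx ⊤ continuous_const fun _ => by positivity
  choose γ hγ1 hγ2 hγ3 using happ
  refine ⟨γ, fun n => 1 / (n + 1 : ℝ), K + 1, hγ1, fun n => by positivity, fun n x hx => ?_,
    fun n x hx => ?_, fun x hx => ?_⟩
  · by_contra hne
    have h1 : χ n x ≠ 0 := right_ne_zero_of_mul (hγ3 n hne)
    have h2 : 0 < (n + 1 : ℝ) * min x (L - x) - 1 := by
      by_contra! h
      exact h1 (max_eq_left (by simp only [min_le_iff]; exact Or.inr h))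
    have hn : (0 : ℝ) < n + 1 := by positivity
    have h3 : 1 / (n + 1 : ℝ) < min x (L - x) := by
      rw [div_lt_iff₀ hn]; linarith
    exact hx ⟨(h3.trans_le (min_le_left _ _)).le, by
      have := h3.trans_le (min_le_right _ _); linarith⟩
  · have h1 := hγ2 n x
    rw [Real.dist_eq] at h1
    have h2 : |G x * χ n x| ≤ K := by
      rw [abs_mul, abs_of_nonneg (hχ0 n x)]
      have := hK x hx
      rw [Real.norm_eq_abs] at this
      nlinarith [hχ0 n x, hχ1 n x, abs_nonneg (G x)]
    have h3 : 1 / (n + 1 : ℝ) ≤ 1 := by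
      rw [div_le_one (by positivity)]; linarith [(Nat.cast_nonneg n : (0 : ℝ) ≤ n)]
    have := abs_sub_abs_le_abs_sub (γ n x) (G x * χ n x)
    linarith
  · have hm : 0 < min x (L - x) := lt_min hx.1 (by linarith [hx.2])
    have h1 : ∀ᶠ n : ℕ in atTop, χ n x = 1 := by
      have ht : Tendsto (fun n : ℕ => (n + 1 : ℝ) * min x (L - x) - 1) atTop atTop :=
        tendsto_atTop_add_const_right _ _ ((tendsto_atTop_add_const_right _ _
          tendsto_natCast_atTop_atTop).atTop_mul_const hm)
      filter_upwards [ht.eventually_ge_atTop 1] with n hn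
      simp only [hχ, min_eq_left hn, max_eq_right zero_le_one]
    rw [tendsto_iff_dist_tendsto_zero]
    refine tendsto_of_tendsto_of_tendsto_of_le_of_le' tendsto_const_nhds
      tendsto_one_div_add_atTop_nhds_zero_nat (Eventually.of_forall fun n => dist_nonneg) ?_
    filter_upwards [h1] with n hn
    have := (hγ2 n x).le
    rwa [hn, mul_one] at this

theorem contDiff_primitive {θ : ℝ → ℝ} (hθ : ContDiff ℝ (⊤ : ℕ∞) θ) :
    ContDiff ℝ (⊤ : ℕ∞) fun x => ∫ t in 0..x, θ t := by
  have hd : ∀ x, HasDerivAt (fun x => ∫ t in 0..x, θ t) (θ x) x := fun x =>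
    hθ.continuous.integral_hasStrictDerivAt 0 x |>.hasDerivAt
  rw [contDiff_infty_iff_deriv]
  refine ⟨fun x => (hd x).differentiableAt, ?_⟩
  rwa [funext fun x => (hd x).deriv]

theorem hasDerivAt_primitive {θ : ℝ → ℝ} (hθ : Continuous θ) (x : ℝ) :
    HasDerivAt (fun x => ∫ t in 0..x, θ t) (θ x) x :=
  (hθ.integral_hasStrictDerivAt 0 x).hasDerivAt

/-- The primitive of a smooth function supported in `[a, L - a]` with integral zero is a test
function. -/
theorem exists_testFunction_primitive {Ω : TopologicalSpace.Opens ℝ} {L a : ℝ} (ha : 0 < a)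
    (hΩ : (Ω : Set ℝ) = Ioo 0 L) {θ : ℝ → ℝ} (hθ : ContDiff ℝ (⊤ : ℕ∞) θ)
    (hsupp : ∀ x, x ∉ Icc a (L - a) → θ x = 0) (hint : ∫ t in 0..L, θ t = 0) :
    ∃ φ : TestFunction Ω ℝ ⊤, ⇑φ = fun x => ∫ t in 0..x, θ t := by
  have hz : ∀ x, x ∉ Icc a (L - a) → ∫ t in 0..x, θ t = 0 := by
    intro x hx
    have hzero : ∀ y z : ℝ, (∀ t ∈ uIcc y z, t ∉ Icc a (L - a)) → ∫ t in y..z, θ t = 0 :=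
      fun y z h => by
        rw [intervalIntegral.integral_congr (g := fun _ => 0) fun t ht => hsupp t (h t ht)]
        simp
    rcases not_and_or.1 hx with h | h
    · refine hzero 0 x fun t ht hta => ?_
      have := ht.2.trans (max_le ha.le (not_le.1 h).le)
      rcases le_or_gt 0 x with h0 | h0
      · rw [uIcc_of_le h0] at ht; linarith [ht.2, hta.1, not_le.1 h]
      · rw [uIcc_of_ge h0.le] at ht; linarith [ht.2, hta.1]
    -- To the right of the support the integral is rebased at `L`, using that the total integral
    -- vanishes.
    · rw [← intervalIntegral.integral_add_adjacent_intervals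
        (hθ.continuous.intervalIntegrable 0 L) (hθ.continuous.intervalIntegrable L x), hint,
        zero_add]
      refine hzero L x fun t ht hta => ?_
      rcases le_or_gt L x with h0 | h0
      · rw [uIcc_of_le h0] at ht; linarith [ht.1, hta.2]
      · rw [uIcc_of_ge h0.le] at ht; linarith [ht.1, hta.2, not_le.1 h]
  have hts : tsupport (fun x => ∫ t in 0..x, θ t) ⊆ Icc a (L - a) :=
    closure_minimal (fun x hx => by by_contra h; exact hx (hz x h)) isClosed_Icc
  refine ⟨⟨fun x => ∫ t in 0..x, θ t, contDiff_primitive hθ,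
    isCompact_Icc.of_isClosed_subset (isClosed_tsupport _) hts, ?_⟩, rfl⟩
  rw [hΩ]
  exact hts.trans fun x hx => ⟨ha.trans_le hx.1, by linarith [hx.2]⟩

/-- A primitive has compact support only if the total integral is zero. The smooth approximants of
`G` are therefore corrected by a multiple of a fixed bump of mass one; the multiples tend to `∫ G =
0`. -/
theorem exists_testFunction_tendsto {Ω : TopologicalSpace.Opens ℝ} {L : ℝ} (hL : 0 < L)
    (hΩ : (Ω : Set ℝ) = Ioo 0 L) {G : ℝ → ℝ} (hG : Continuous G) (hint : ∫ t in 0..L, G t = 0) :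
    ∃ (φ : ℕ → TestFunction Ω ℝ ⊤) (K : ℝ),
      (∀ n, ∀ x ∈ Icc 0 L, |G x - deriv (φ n) x| ≤ K) ∧
      (∀ x ∈ Ioo 0 L, Tendsto (fun n => G x - deriv (φ n) x) atTop (𝓝 0)) ∧
      ∀ n x, φ n x = ∫ t in 0..x, deriv (φ n) t := by
  obtain ⟨γ, a, K, hγ, ha, hsupp, hK, hlim⟩ := exists_contDiff_tendsto_of_continuous (L := L) hG
  -- The outer radius `L/4` keeps the bump inside `[L/4, L - L/4]`.
  let β : ContDiffBump (L / 2) := ⟨L / 8, L / 4, by positivity, by linarith⟩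
  set b : ℝ → ℝ := β.normed volume with hb
  have hbs : ContDiff ℝ (⊤ : ℕ∞) b := β.contDiff_normed
  have hb0 : ∀ x, x ∉ Icc (L / 4) (L - L / 4) → b x = 0 := fun x hx => by
    by_contra hne
    have : x ∈ Function.support b := hne
    rw [hb, β.support_normed_eq, Real.ball_eq_Ioo] at this
    exact hx ⟨by have := this.1; simp only [β] at this; linarith,
      by have := this.2; simp only [β] at this; linarith⟩
  have hbint : ∫ t in 0..L, b t = 1 := by
    rw [← β.integral_normed (μ := volume), intervalIntegral.integral_of_le hL.le]
    refine setIntegral_eq_integral_of_forall_compl_eq_zero fun x hx => hb0 x fun h => hx ?_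
    exact ⟨by linarith [h.1], by linarith [h.2]⟩
  set I : ℕ → ℝ := fun n => ∫ t in 0..L, γ n t with hI
  have hIlim : Tendsto I atTop (𝓝 0) := by
    rw [← hint]
    refine intervalIntegral.tendsto_integral_filter_of_dominated_convergence (fun _ => K)
      (Eventually.of_forall fun n => (hγ n).continuous.aestronglyMeasurable)
      (Eventually.of_forall fun n => Eventually.of_forall fun x hx => ?_)
      intervalIntegrable_const ?_
    · rw [uIoc_of_le hL.le] at hx; exact hK n x (Ioc_subset_Icc_self hx)
    · filter_upwards [Measure.ae_ne volume L] with x hxL hx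
      rw [uIoc_of_le hL.le] at hx
      exact hlim x ⟨hx.1, lt_of_le_of_ne hx.2 hxL⟩
  set θ : ℕ → ℝ → ℝ := fun n x => γ n x - I n * b x with hθ
  have hθs : ∀ n, ContDiff ℝ (⊤ : ℕ∞) (θ n) := fun n => (hγ n).sub (contDiff_const.mul hbs)
  have hθint : ∀ n, ∫ t in 0..L, θ n t = 0 := fun n => by
    have hc : Continuous fun x => I n * b x := continuous_const.mul hbs.continuous
    simp only [hθ]
    rw [intervalIntegral.integral_sub ((hγ n).continuous.intervalIntegrable _ _)
      (hc.intervalIntegrable _ _),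
      intervalIntegral.integral_const_mul, hbint]
    simp [hI]
  have hφ : ∀ n, ∃ φ : TestFunction Ω ℝ ⊤, ⇑φ = fun x => ∫ t in 0..x, θ n t := fun n => by
    refine exists_testFunction_primitive (a := min (a n) (L / 4)) (lt_min (ha n) (by positivity))
      hΩ (hθs n) (fun x hx => ?_) (hθint n)
    have h1 : γ n x = 0 := hsupp n x fun h => hx
      ⟨(min_le_left _ _).trans h.1, by linarith [h.2, min_le_left (a n) (L / 4)]⟩
    have h2 : b x = 0 := hb0 x fun h => hx
      ⟨(min_le_right _ _).trans h.1, by linarith [h.2, min_le_right (a n) (L / 4)]⟩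
    simp [hθ, h1, h2]
  choose φ hφ using hφ
  have hd : ∀ n x, deriv (φ n) x = θ n x := fun n x => by
    rw [hφ n]; exact (hasDerivAt_primitive (hθs n).continuous x).deriv
  obtain ⟨K1, hK1⟩ := isCompact_Icc.exists_bound_of_continuousOn (s := Icc 0 L) hG.continuousOn
  obtain ⟨K2, hK2⟩ := isCompact_Icc.exists_bound_of_continuousOn (s := Icc 0 L)
    hbs.continuous.continuousOn
  obtain ⟨K3, hK3⟩ := hIlim.abs.bddAbove_range
  refine ⟨φ, K1 + (K + K3 * K2), fun n x hx => ?_, fun x hx => ?_, fun n x => ?_⟩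
  · rw [hd]
    have h1 := hK1 x hx
    have h2 := hK2 x hx
    have h3 : |I n| ≤ K3 := hK3 ⟨n, rfl⟩
    rw [Real.norm_eq_abs] at h1 h2
    have h4 : |I n * b x| ≤ K3 * K2 := by
      rw [abs_mul]; exact mul_le_mul h3 h2 (abs_nonneg _) ((abs_nonneg _).trans h3)
    calc |G x - θ n x| ≤ |G x| + |θ n x| := abs_sub _ _
      _ ≤ |G x| + (|γ n x| + |I n * b x|) := by gcongr; exact abs_sub _ _
      _ ≤ _ := by gcongr; exact hK n x hx
  · simp only [hd]
    have := (hlim x hx).sub (hIlim.mul_const (b x))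
    simpa using this.const_sub (G x)
  · simp only [hd]; rw [hφ]

/-- Bounded pointwise convergence of the derivatives gives `L^p` convergence of the derivatives and,
after integration, of the functions. This certifies that an explicit `C^1` function lies in the
closure of the test functions. -/
theorem memW1pZero_primitive {p : ℝ} (hp : 1 < p) (hL : 0 < pip p) {G : ℝ → ℝ}
    (hG : Continuous G) (hint : ∫ t in 0..pip p, G t = 0) :
    MemW1pZero (intervalp p) p (fun x => ∫ t in 0..x, G t) G := by
  set u : ℝ → ℝ := fun x => ∫ t in 0..x, G t with hu
  have hΩ : (intervalp p : Set ℝ) = Ioo 0 (pip p) := rfl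
  have hud : ∀ x, HasDerivAt u (G x) x := hasDerivAt_primitive hG
  have huc : Continuous u := continuous_iff_continuousAt.2 fun x => (hud x).continuousAt
  have hp0 : 0 < p := by linarith
  have hmem : ∀ f : ℝ → ℝ, Continuous f →
      MemLp f (ENNReal.ofReal p) (volume.restrict (Ioo 0 (pip p))) := fun f hf =>
    (ContinuousOn.memLp_top_Ioo hf.continuousOn).mono_exponent le_top
  refine ⟨⟨hmem u huc, hmem G hG, huc.locallyIntegrable.locallyIntegrableOn _,
    hG.locallyIntegrable.locallyIntegrableOn _, fun φ => ?_⟩, ?_⟩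
  · rw [hΩ, ← integral_Ioc_eq_integral_Ioo, ← integral_Ioc_eq_integral_Ioo,
      ← intervalIntegral.integral_of_le hL.le, ← intervalIntegral.integral_of_le hL.le]
    have h0 : ∀ y, y ∉ Ioo 0 (pip p) → φ y = 0 := fun y hy =>
      image_eq_zero_of_notMem_tsupport fun h => hy (φ.tsupport_subset h)
    have hφd : ∀ x, HasDerivAt φ (deriv φ x) x := fun x =>
      (φ.contDiff.differentiable (by simp) x).hasDerivAt
    rw [intervalIntegral.integral_mul_deriv_eq_deriv_mul (fun x _ => hud x) (fun x _ => hφd x)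
      (hG.intervalIntegrable _ _) (φ.continuous_deriv.intervalIntegrable _ _),
      h0 0 (by simp), h0 (pip p) (by simp)]
    simp
  · obtain ⟨φ, K, hK, hlim, hprim⟩ := exists_testFunction_tendsto hL hΩ hG hint
    have hc : ∀ n, Continuous fun t => G t - deriv (φ n) t := fun n =>
      hG.sub (φ n).continuous_deriv
    have hsub : ∀ n x, u x - φ n x = ∫ t in 0..x, (G t - deriv (φ n) t) := fun n x => by
      rw [hprim n x, intervalIntegral.integral_sub (hG.intervalIntegrable _ _)
        ((φ n).continuous_deriv.intervalIntegrable _ _)]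
    rw [hΩ]
    refine ⟨φ, tendsto_eLpNorm_zero_of_bounded (K := K * pip p) hp0
      (fun n => (huc.sub (φ n).continuous).aestronglyMeasurable) (fun n => ?_) ?_,
      tendsto_eLpNorm_zero_of_bounded (K := K) hp0 (fun n => (hc n).aestronglyMeasurable)
        (fun n => ?_) ?_⟩
    · filter_upwards [ae_restrict_mem measurableSet_Ioo] with x hx
      rw [hsub, ← Real.norm_eq_abs]
      have hK0 : 0 ≤ K := (abs_nonneg _).trans (hK n 0 (left_mem_Icc.2 hL.le))
      refine (intervalIntegral.norm_integral_le_of_norm_le_const (C := K) fun t ht => ?_).trans ?_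
      · rw [uIoc_of_le hx.1.le] at ht
        exact hK n t ⟨ht.1.le, ht.2.trans hx.2.le⟩
      · rw [sub_zero, abs_of_pos hx.1]
        exact mul_le_mul_of_nonneg_left hx.2.le hK0
    · filter_upwards [ae_restrict_mem measurableSet_Ioo] with x hx
      simp only [hsub]
      have : Tendsto (fun n => ∫ t in 0..x, (G t - deriv (φ n) t)) atTop
          (𝓝 (∫ t in 0..x, (0 : ℝ))) := by
        refine intervalIntegral.tendsto_integral_filter_of_dominated_convergence (fun _ => K)
          (Eventually.of_forall fun n => (hc n).aestronglyMeasurable)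
          (Eventually.of_forall fun n => Eventually.of_forall fun t ht => ?_)
          intervalIntegrable_const (Eventually.of_forall fun t ht => ?_)
        · rw [uIoc_of_le hx.1.le] at ht
          exact hK n t ⟨ht.1.le, ht.2.trans hx.2.le⟩
        · rw [uIoc_of_le hx.1.le] at ht
          exact hlim t ⟨ht.1, ht.2.trans_lt hx.2⟩
      simpa using this
    · filter_upwards [ae_restrict_mem measurableSet_Ioo] with x hx
      exact hK n x (Ioo_subset_Icc_self hx)
    · filter_upwards [ae_restrict_mem measurableSet_Ioo] with x hx using hlim x hx

/-! ### Solutions that are symmetric about the midpoint -/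

/-- For `p < 2` the factor `|y|^(p-2)` is singular at `0`; continuity comes from recognising `1/p`
times the derivative of the `C^1` function `|y|^p`. -/
theorem continuous_rpow_mul_self {p : ℝ} (hp : 1 < p) :
    Continuous fun y : ℝ => |y| ^ (p - 2) * y := by
  have h1 : ContDiff ℝ 1 fun x : ℝ => |x| ^ p := by
    simpa only [Real.norm_eq_abs] using contDiff_norm_rpow (E := ℝ) hp
  have h2 := h1.continuous_deriv le_rfl
  have h3 : (fun y : ℝ => |y| ^ (p - 2) * y) = fun y => p⁻¹ * deriv (fun x : ℝ => |x| ^ p) y := by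
    ext y
    rw [(hasDerivAt_abs_rpow y hp).deriv]
    field_simp
  rw [h3]
  exact continuous_const.mul h2

theorem rpow_mul_self_of_nonneg {p : ℝ} (hp : 1 < p) {y : ℝ} (hy : 0 ≤ y) :
    |y| ^ (p - 2) * y = y ^ (p - 1) := by
  have h := rpow_mul_self_abs hp y
  rw [abs_of_nonneg (mul_nonneg (Real.rpow_nonneg (abs_nonneg _) _) hy)] at h
  rw [h, abs_of_nonneg hy]

theorem integral_eq_add_reflect {L : ℝ} {f : ℝ → ℝ} (hL : 0 ≤ L)
    (hf : ContinuousOn f (Icc 0 L)) :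
    ∫ x in 0..L, f x = ∫ x in 0..(L / 2), (f x + f (L - x)) := by
  have h1 : IntervalIntegrable f volume 0 (L / 2) :=
    (hf.mono (by rw [uIcc_of_le (by linarith)]; exact Icc_subset_Icc le_rfl (by linarith))
      ).intervalIntegrable
  have h2 : IntervalIntegrable f volume (L / 2) L :=
    (hf.mono (by rw [uIcc_of_le (by linarith)]; exact Icc_subset_Icc (by linarith) le_rfl)
      ).intervalIntegrable
  have h3 : IntervalIntegrable (fun x => f (L - x)) volume 0 (L / 2) := by
    have := (h2.comp_sub_left L).symm
    simpa [sub_half] using this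
  rw [intervalIntegral.integral_add h1 h3, intervalIntegral.integral_comp_sub_left f L,
    sub_half, sub_zero, intervalIntegral.integral_add_adjacent_intervals h1 h2]

/-- Here `γ` is the derivative of the solution on the left half and `V'` the derivative of its flux.
As `γ` vanishes at the midpoint, the even extension has continuous flux, so the equation holds
across the midpoint without a point mass. -/
theorem hasNontrivialSolution_of_half {p lam : ℝ} (hp : 1 < p) (hL : 0 < pip p)
    {γ ρ V' : ℝ → ℝ} (hγ : Continuous γ) (hγ0 : ∀ x, 0 ≤ γ x)
    (hγm : ∀ x, pip p / 2 ≤ x → γ x = 0) (hU : ∀ x ∈ Ioo 0 (pip p / 2), 0 < ∫ t in 0..x, γ t)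
    (hρ : ContinuousOn ρ (Icc 0 (pip p / 2)))
    (hV : ∀ x ∈ Ioo 0 (pip p / 2), HasDerivAt (fun x => γ x ^ (p - 1)) (V' x) x)
    (heq : ∀ x ∈ Icc 0 (pip p / 2), V' x = -((lam + ρ x) * (∫ t in 0..x, γ t) ^ (p - 1))) :
    ContinuousOn (fun x => ρ (min x (pip p - x))) (Icc 0 (pip p)) ∧
      HasNontrivialSolution p lam fun x => ρ (min x (pip p - x)) := by
  set L := pip p with hLdef
  have hp1 : 0 < p - 1 := by linarith
  have hr : ContinuousOn (fun x => ρ (min x (L - x))) (Icc 0 L) := by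
    refine hρ.comp (by fun_prop) fun x hx => ⟨le_min hx.1 (by linarith [hx.2]), ?_⟩
    rcases le_total x (L / 2) with h | h
    · exact (min_le_left _ _).trans h
    · exact (min_le_right _ _).trans (by linarith)
  refine ⟨hr, ?_⟩
  set G : ℝ → ℝ := fun x => γ x - γ (L - x) with hG
  have hGc : Continuous G := hγ.sub (hγ.comp (continuous_const.sub continuous_id))
  have hGref : ∀ x, G (L - x) = -G x := fun x => by simp [hG]
  have hGhalf : ∀ x ∈ Icc 0 (L / 2), G x = γ x := fun x hx => by
    simp [hG, hγm (L - x) (by linarith [hx.2])]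
  have hGint : ∫ t in 0..L, G t = 0 := by
    rw [integral_eq_add_reflect hL.le hGc.continuousOn]
    simp [hGref]
  set u : ℝ → ℝ := fun x => ∫ t in 0..x, G t with hu
  have huc : Continuous u :=
    continuous_iff_continuousAt.2 fun x => (hasDerivAt_primitive hGc x).continuousAt
  have huref : ∀ x, u (L - x) = u x := fun x => by
    have h1 : ∫ t in 0..x, G (L - t) = ∫ t in (L - x)..L, G t := by
      rw [intervalIntegral.integral_comp_sub_left G L, sub_zero]
    simp only [hGref, intervalIntegral.integral_neg] at h1
    have h2 := intervalIntegral.integral_add_adjacent_intervals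
      (hGc.intervalIntegrable (μ := volume) 0 (L - x)) (hGc.intervalIntegrable (L - x) L)
    simp only [hu]
    linarith
  have huhalf : ∀ x ∈ Icc 0 (L / 2), u x = ∫ t in 0..x, γ t := fun x hx => by
    refine intervalIntegral.integral_congr fun t ht => ?_
    rw [uIcc_of_le hx.1] at ht
    exact hGhalf t ⟨ht.1, ht.2.trans hx.2⟩
  refine ⟨u, ⟨G, memW1pZero_primitive hp hL hGc hGint, fun φ => ?_⟩, fun h0 => ?_⟩
  · have hφd : ∀ x, HasDerivAt φ (deriv φ x) x := fun x =>
      (φ.contDiff.differentiable (by simp) x).hasDerivAt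
    have hz : ∀ y, y ∉ Ioo 0 L → φ y = 0 := fun y hy =>
      image_eq_zero_of_notMem_tsupport fun h => hy (φ.tsupport_subset h)
    rw [← integral_Ioc_eq_integral_Ioo, ← integral_Ioc_eq_integral_Ioo,
      ← intervalIntegral.integral_of_le hL.le, ← intervalIntegral.integral_of_le hL.le]
    have hHc : Continuous fun x => |G x| ^ (p - 2) * G x := (continuous_rpow_mul_self hp).comp hGc
    have hKc : Continuous fun x => |u x| ^ (p - 2) * u x := (continuous_rpow_mul_self hp).comp huc
    have k1 := integral_eq_add_reflect (f := fun x => |G x| ^ (p - 2) * G x * deriv φ x) hL.le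
      (hHc.mul φ.continuous_deriv).continuousOn
    have k2 := integral_eq_add_reflect
      (f := fun x => (lam + ρ (min x (L - x))) * (|u x| ^ (p - 2) * u x) * φ x) hL.le
        (((continuousOn_const.add hr).mul hKc.continuousOn).mul φ.continuous.continuousOn)
    -- By symmetry only the even part of the test function counts, so the weak form reduces to an
    -- integration by parts on the left half.
    set ψ : ℝ → ℝ := fun x => φ x + φ (L - x) with hψ
    set ψ' : ℝ → ℝ := fun x => deriv φ x - deriv φ (L - x) with hψ'
    have hψd : ∀ x, HasDerivAt ψ (ψ' x) x := fun x => by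
      have := (hφd x).add ((hφd (L - x)).comp x ((hasDerivAt_id x).const_sub L))
      exact this.congr_deriv (by simp [hψ', sub_eq_add_neg])
    have hψ'c : Continuous ψ' :=
      φ.continuous_deriv.sub (φ.continuous_deriv.comp (continuous_const.sub continuous_id))
    have hψc : Continuous ψ := continuous_iff_continuousAt.2 fun x => (hψd x).continuousAt
    have hψ0 : ψ 0 = 0 := by simp [hψ, hz 0 (by simp), hz L (by simp)]
    have hm0 : 0 ≤ L / 2 := by positivity
    have hUc : Continuous fun x => ∫ t in 0..x, γ t :=
      continuous_iff_continuousAt.2 fun x => (hasDerivAt_primitive hγ x).continuousAt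
    have hV'c : ContinuousOn V' (Icc 0 (L / 2)) :=
      ContinuousOn.congr (((continuousOn_const.add hρ).mul
        (hUc.rpow_const fun _ => Or.inr hp1.le).continuousOn).neg) heq
    have hparts := intervalIntegral.integral_mul_deriv_eq_deriv_mul_of_hasDerivAt
      (a := 0) (b := L / 2) (u := fun x => γ x ^ (p - 1)) (v := ψ) (u' := V') (v' := ψ')
      (hγ.rpow_const fun _ => Or.inr hp1.le).continuousOn hψc.continuousOn
      (fun x hx => hV x (by rwa [min_eq_left hm0, max_eq_right hm0] at hx)) (fun x _ => hψd x)
      (ContinuousOn.intervalIntegrable (by rwa [uIcc_of_le hm0])) (hψ'c.intervalIntegrable _ _)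
    -- Both boundary terms vanish: `ψ` at `0`, the flux at the midpoint.
    rw [hψ0, hγm _ le_rfl, Real.zero_rpow hp1.ne'] at hparts
    have e1 : ∫ x in 0..(L / 2), (|G x| ^ (p - 2) * G x * deriv φ x
        + |G (L - x)| ^ (p - 2) * G (L - x) * deriv φ (L - x))
        = ∫ x in 0..(L / 2), γ x ^ (p - 1) * ψ' x := by
      refine intervalIntegral.integral_congr fun x hx => ?_
      rw [uIcc_of_le hm0] at hx
      have h1 := rpow_mul_self_of_nonneg hp (hγ0 x)
      simp only [hGref, abs_neg, hGhalf x hx, hψ', ← h1]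
      ring
    have e2 : ∫ x in 0..(L / 2), ((lam + ρ (min x (L - x))) * (|u x| ^ (p - 2) * u x) * φ x
        + (lam + ρ (min (L - x) (L - (L - x)))) * (|u (L - x)| ^ (p - 2) * u (L - x)) * φ (L - x))
        = -∫ x in 0..(L / 2), V' x * ψ x := by
      rw [← intervalIntegral.integral_neg]
      refine intervalIntegral.integral_congr fun x hx => ?_
      rw [uIcc_of_le hm0] at hx
      have h0 : 0 ≤ ∫ t in 0..x, γ t := intervalIntegral.integral_nonneg hx.1 fun t _ => hγ0 t
      have h1 := rpow_mul_self_of_nonneg hp h0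
      simp only [huref, huhalf x hx, sub_sub_cancel, min_eq_left (by linarith [hx.2] : x ≤ L - x),
        min_eq_right (by linarith [hx.2] : x ≤ L - x), heq x hx, hψ, h1]
      ring
    rw [k1, k2, e1, e2, hparts]
    ring
  · have hzero : ∀ᵐ x ∂(volume.restrict (Ioo 0 (L / 2))), False := by
      have h1 := ae_restrict_of_ae_restrict_of_subset
        (Ioo_subset_Ioo_right (by linarith : L / 2 ≤ L)) h0
      filter_upwards [h1, ae_restrict_mem measurableSet_Ioo] with x hx hxI
      have := hU x hxI
      rw [← huhalf x (Ioo_subset_Icc_self hxI), hx] at this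
      simp at this
    rw [eventually_false_iff_eq_bot, ae_eq_bot, Measure.restrict_eq_zero, Real.volume_Ioo,
      ENNReal.ofReal_eq_zero] at hzero
    linarith

/-! ### Nearly optimal potentials -/

theorem hasDerivAt_max_zero_sq (x : ℝ) : HasDerivAt (fun x : ℝ => max x 0 ^ 2) (2 * max x 0) x := by
  have hne : ∀ y : ℝ, y ≠ 0 → HasDerivAt (fun x : ℝ => max x 0 ^ 2) (2 * max y 0) y := by
    intro y hy
    rcases lt_or_gt_of_ne hy with h | h
    · rw [max_eq_right h.le, mul_zero]
      refine (hasDerivAt_const y (0 : ℝ)).congr_of_eventuallyEq ?_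
      filter_upwards [Iio_mem_nhds h] with z hz
      simp [max_eq_right (le_of_lt hz : z ≤ 0)]
    · rw [max_eq_left h.le]
      refine ((hasDerivAt_pow 2 y).congr_of_eventuallyEq ?_).congr_deriv (by simp)
      filter_upwards [Ioi_mem_nhds h] with z hz
      simp [max_eq_left (le_of_lt hz : 0 ≤ z)]
  rcases eq_or_ne x 0 with rfl | hx
  · exact hasDerivAt_of_hasDerivAt_of_ne hne (by fun_prop) (by fun_prop)
  · exact hne x hx

/-- Data of a positive increasing solution of the equation with `r = 0` on half the interval: `s`
is the solution and `c` its derivative. -/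
structure IsHalfSolution (p lam m : ℝ) (s c : ℝ → ℝ) : Prop where
  continuousOn_s : ContinuousOn s (Icc 0 m)
  s_zero : s 0 = 0
  hasDerivAt_s : ∀ x ∈ Ioo 0 m, HasDerivAt s (c x) x
  continuousOn_c : ContinuousOn c (Icc 0 m)
  c_pos : ∀ x ∈ Icc 0 m, 0 < c x
  hasDerivAt_c : ∀ x ∈ Ioo 0 m,
    HasDerivAt (fun x => c x ^ (p - 1)) (-lam * s x ^ (p - 1)) x

namespace IsHalfSolution

variable {p lam m : ℝ} {s c : ℝ → ℝ}

theorem strictMonoOn_s (h : IsHalfSolution p lam m s c) : StrictMonoOn s (Icc 0 m) := by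
  refine strictMonoOn_of_deriv_pos (convex_Icc _ _) h.continuousOn_s fun x hx => ?_
  rw [interior_Icc] at hx
  rw [(h.hasDerivAt_s x hx).deriv]
  exact h.c_pos x (Ioo_subset_Icc_self hx)

theorem s_pos (h : IsHalfSolution p lam m s c) {x : ℝ} (hx : x ∈ Ioc 0 m) : 0 < s x := by
  have := h.strictMonoOn_s (left_mem_Icc.2 (hx.1.le.trans hx.2)) (Ioc_subset_Icc_self hx) hx.1
  rwa [h.s_zero] at this

theorem integral_c (h : IsHalfSolution p lam m s c) {x : ℝ} (hx : x ∈ Icc 0 m) :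
    ∫ t in 0..x, c t = s x := by
  have hsub : Icc 0 x ⊆ Icc 0 m := Icc_subset_Icc le_rfl hx.2
  rw [intervalIntegral.integral_eq_sub_of_hasDerivAt_of_le hx.1 (h.continuousOn_s.mono hsub)
    (fun y hy => h.hasDerivAt_s y ⟨hy.1, hy.2.trans_le hx.2⟩)
    (ContinuousOn.intervalIntegrable (by rw [uIcc_of_le hx.1]; exact h.continuousOn_c.mono hsub)),
    h.s_zero, sub_zero]

/-- The flux `c^(p-1)` is multiplied by `1 - η`, with `η` rising from `0` at `a` to `1` at the
midpoint, and the equation is solved for the potential. The potential is zero left of `a`; on `[a,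
L/2]` its dominant part is `c^(p-1) η' / U^(p-1)`, and `η'` has mass one. Reflection supplies the
factor `2`. -/
theorem exists_potential (hp : 1 < p) (hL : 0 < pip p)
    (h : IsHalfSolution p lam (pip p / 2) s c) {a Q : ℝ} (ha : 0 < a) (ham : a < pip p / 2)
    (hQ : ∀ x ∈ Icc a (pip p / 2), c x ^ (p - 1) ≤ Q) :
    ∃ r : ℝ → ℝ, ContinuousOn r (Icc 0 (pip p)) ∧ HasNontrivialSolution p lam r ∧
      normPosPart p r ≤ 2 * ((pip p / 2 - a) *
        (|lam| + |lam| * s (pip p / 2) ^ (p - 1) / s a ^ (p - 1)) + Q / s a ^ (p - 1)) := by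
  have hp1 : 0 < p - 1 := by linarith
  set L := pip p with hLdef
  set m := L / 2 with hm
  have hm0 : 0 < m := by positivity
  have hma : 0 < m - a := by linarith
  -- Clamping the argument makes `c` continuous and positive on all of `ℝ`.
  set ch : ℝ → ℝ := fun x => c (max 0 (min x m)) with hch
  have hclamp : ∀ x ∈ Icc 0 m, max 0 (min x m) = x := fun x hx => by
    rw [min_eq_left hx.2, max_eq_right hx.1]
  have hchc : Continuous ch := h.continuousOn_c.comp_continuous (by fun_prop) fun x =>
    ⟨le_max_left _ _, max_le hm0.le (min_le_right _ _)⟩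
  have hch0 : ∀ x, 0 < ch x := fun x =>
    h.c_pos _ ⟨le_max_left _ _, max_le hm0.le (min_le_right _ _)⟩
  have hche : ∀ x ∈ Icc 0 m, ch x = c x := fun x hx => by simp only [hch, hclamp x hx]
  set η : ℝ → ℝ := fun x => max (x - a) 0 ^ 2 / (m - a) ^ 2 with hη
  set η' : ℝ → ℝ := fun x => 2 * max (x - a) 0 / (m - a) ^ 2 with hη'
  have hηd : ∀ x, HasDerivAt η (η' x) x := fun x => by
    have := ((hasDerivAt_max_zero_sq (x - a)).comp x ((hasDerivAt_id x).sub_const a)).div_const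
      ((m - a) ^ 2)
    exact this.congr_deriv (by simp [hη'])
  have hηc : Continuous η := by fun_prop
  have hη'c : Continuous η' := by fun_prop
  have hη0 : ∀ x ≤ a, η x = 0 := fun x hx => by simp [hη, max_eq_right (sub_nonpos.2 hx)]
  have hη'0 : ∀ x ≤ a, η' x = 0 := fun x hx => by simp [hη', max_eq_right (sub_nonpos.2 hx)]
  have hηnn : ∀ x, 0 ≤ η x := fun x => by positivity
  have hη'nn : ∀ x, 0 ≤ η' x := fun x => by positivity
  have hη1 : ∀ x < m, η x < 1 := fun x hx => by
    rw [hη]; simp only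
    rw [div_lt_one (by positivity)]
    exact pow_lt_pow_left₀ (max_lt (by linarith) hma) (le_max_right _ _) two_ne_zero
  have hηm : ∀ x, m ≤ x → 1 ≤ η x := fun x hx => by
    rw [hη]; simp only
    rw [one_le_div (by positivity)]
    exact pow_le_pow_left₀ hma.le ((by linarith : m - a ≤ x - a).trans (le_max_left _ _)) 2
  have hηle : ∀ x ≤ m, η x ≤ 1 := fun x hx => by
    rcases hx.lt_or_eq with hlt | rfl
    · exact (hη1 x hlt).le
    · simp only [hη]; rw [max_eq_left hma.le, div_self (by positivity)]
  -- The exponent `1/(p-1)` makes `γ^(p-1)` linear in the cutoff.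
  set γ : ℝ → ℝ := fun x => ch x * (max 0 (1 - η x)) ^ (1 / (p - 1)) with hγ
  have hγc : Continuous γ := hchc.mul
    ((continuous_const.max (continuous_const.sub hηc)).rpow_const fun _ =>
      Or.inr (by positivity))
  have hγ0 : ∀ x, 0 ≤ γ x := fun x =>
    mul_nonneg (hch0 x).le (Real.rpow_nonneg (le_max_left _ _) _)
  have hγm : ∀ x, m ≤ x → γ x = 0 := fun x hx => by
    simp only [hγ]
    rw [max_eq_left (by linarith [hηm x hx]), Real.zero_rpow (by positivity), mul_zero]
  have hγpow : ∀ x, γ x ^ (p - 1) = ch x ^ (p - 1) * max 0 (1 - η x) := fun x => by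
    simp only [hγ]
    rw [Real.mul_rpow (hch0 x).le (Real.rpow_nonneg (le_max_left _ _) _),
      ← Real.rpow_mul (le_max_left _ _), one_div_mul_cancel hp1.ne', Real.rpow_one]
  set U : ℝ → ℝ := fun x => ∫ t in 0..x, γ t with hU
  have hUc : Continuous U :=
    continuous_iff_continuousAt.2 fun x => (hasDerivAt_primitive hγc x).continuousAt
  have hUmono : Monotone U :=
    monotone_of_deriv_nonneg (fun x => (hasDerivAt_primitive hγc x).differentiableAt) fun x => by
      rw [(hasDerivAt_primitive hγc x).deriv]; exact hγ0 x
  have hUs : ∀ x ∈ Icc 0 a, U x = s x := fun x hx => by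
    rw [← h.integral_c ⟨hx.1, hx.2.trans ham.le⟩]
    refine intervalIntegral.integral_congr fun t ht => ?_
    rw [uIcc_of_le hx.1] at ht
    simp only [hγ]
    rw [hη0 t (ht.2.trans hx.2), hche t ⟨ht.1, ht.2.trans (hx.2.trans ham.le)⟩]
    simp
  have hsa : 0 < s a := h.s_pos ⟨ha, ham.le⟩
  have hUa : ∀ x, a ≤ x → s a ≤ U x := fun x hx => by
    rw [← hUs a ⟨ha.le, le_rfl⟩]; exact hUmono hx
  have hUpos : ∀ x ∈ Ioo 0 m, 0 < U x := fun x hx => by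
    rcases le_total x a with hxa | hxa
    · rw [hUs x ⟨hx.1.le, hxa⟩]; exact h.s_pos ⟨hx.1, hx.2.le⟩
    · exact hsa.trans_le (hUa x hxa)
  set V' : ℝ → ℝ := fun x => -lam * s x ^ (p - 1) * (1 - η x) - c x ^ (p - 1) * η' x with hV'
  have hV'c : ContinuousOn V' (Icc 0 m) :=
    ((continuousOn_const.mul (h.continuousOn_s.rpow_const fun _ _ => Or.inr hp1.le)).mul
      (continuousOn_const.sub hηc.continuousOn)).sub
      ((h.continuousOn_c.rpow_const fun _ _ => Or.inr hp1.le).mul hη'c.continuousOn)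
  have hVd : ∀ x ∈ Ioo 0 m, HasDerivAt (fun x => γ x ^ (p - 1)) (V' x) x := fun x hx => by
    have h1 := (h.hasDerivAt_c x hx).mul ((hηd x).const_sub 1)
    refine (h1.congr_of_eventuallyEq ?_).congr_deriv (by simp only [hV']; ring)
    filter_upwards [Ioo_mem_nhds hx.1 hx.2] with y hy
    rw [hγpow, hche y (Ioo_subset_Icc_self hy), max_eq_right (by linarith [hη1 y hy.2])]
    rfl
  -- Freezing the argument at `a` avoids dividing by `U 0 = 0`; the value at `a` is `0`, which is
  -- what the uncut equation requires on `[0, a]`.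
  set ρ : ℝ → ℝ := fun x => -lam - V' (max x a) / U (max x a) ^ (p - 1) with hρ
  have hρc : ContinuousOn ρ (Icc 0 m) := by
    refine continuousOn_const.sub (ContinuousOn.div ?_ ?_ fun x hx => ?_)
    · exact hV'c.comp (by fun_prop) fun x hx =>
        ⟨hx.1.trans (le_max_left _ _), max_le hx.2 ham.le⟩
    · exact ((hUc.comp (continuous_id.max continuous_const)).rpow_const fun _ =>
        Or.inr hp1.le).continuousOn
    · exact (Real.rpow_pos_of_pos (hsa.trans_le (hUa _ (le_max_right _ _))) _).ne'
  have hV'a : ∀ x ≤ a, V' x = -lam * s x ^ (p - 1) := fun x hx => by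
    simp [hV', hη0 x hx, hη'0 x hx]
  have hρ0 : ∀ x ≤ a, ρ x = 0 := fun x hx => by
    simp only [hρ]
    rw [max_eq_right hx, hV'a a le_rfl, hUs a ⟨ha.le, le_rfl⟩,
      mul_div_assoc, div_self (Real.rpow_pos_of_pos hsa _).ne']
    ring
  have heq : ∀ x ∈ Icc 0 m, V' x = -((lam + ρ x) * U x ^ (p - 1)) := fun x hx => by
    rcases le_total x a with hxa | hxa
    · rw [hρ0 x hxa, hV'a x hxa, hUs x ⟨hx.1, hxa⟩]; ring
    · have := (Real.rpow_pos_of_pos (hsa.trans_le (hUa x hxa)) (p - 1)).ne'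
      simp only [hρ]
      rw [max_eq_left hxa]
      field_simp
      ring
  obtain ⟨hr, hsol⟩ := hasNontrivialSolution_of_half hp hL hγc hγ0 hγm hUpos hρc hVd heq
  refine ⟨_, hr, hsol, ?_⟩
  have hρpc : ContinuousOn (fun x => max (ρ x) 0) (Icc 0 m) := hρc.sup continuousOn_const
  have hnorm : normPosPart p (fun x => ρ (min x (L - x))) = 2 * ∫ x in 0..m, max (ρ x) 0 := by
    rw [normPosPart, ← integral_Ioc_eq_integral_Ioo, ← intervalIntegral.integral_of_le hL.le,
      integral_eq_add_reflect hL.le (hr.sup continuousOn_const),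
      ← intervalIntegral.integral_const_mul]
    refine intervalIntegral.integral_congr fun x hx => ?_
    rw [uIcc_of_le hm0.le] at hx
    have hx2 : x ≤ L / 2 := hx.2
    simp only [← hLdef, sub_sub_cancel, min_eq_left (by linarith : x ≤ L - x),
      min_eq_right (by linarith : x ≤ L - x)]
    ring
  rw [hnorm]
  refine mul_le_mul_of_nonneg_left ?_ zero_le_two
  have hSA : 0 < s a ^ (p - 1) := Real.rpow_pos_of_pos hsa _
  have hsplit := intervalIntegral.integral_add_adjacent_intervals (μ := volume)
    (f := fun x => max (ρ x) 0) (a := 0) (b := a) (c := m)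
    (ContinuousOn.intervalIntegrable (by
      rw [uIcc_of_le ha.le]; exact hρpc.mono (Icc_subset_Icc le_rfl ham.le)))
    (ContinuousOn.intervalIntegrable (by
      rw [uIcc_of_le ham.le]; exact hρpc.mono (Icc_subset_Icc ha.le le_rfl)))
  have hz : ∫ x in 0..a, max (ρ x) 0 = 0 := by
    rw [intervalIntegral.integral_congr (g := fun _ => 0)]
    · simp
    · intro x hx
      rw [uIcc_of_le ha.le] at hx
      simp [hρ0 x hx.2]
  rw [← hsplit, hz, zero_add]
  set B : ℝ := |lam| + |lam| * s m ^ (p - 1) / s a ^ (p - 1) with hB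
  have hbound : ∀ x ∈ Icc a m, max (ρ x) 0 ≤ B + Q / s a ^ (p - 1) * η' x := by
    intro x hx
    have hx0 : x ∈ Icc 0 m := ⟨ha.le.trans hx.1, hx.2⟩
    have hcx : 0 < c x ^ (p - 1) := Real.rpow_pos_of_pos (h.c_pos x hx0) _
    have hQx := hQ x hx
    have hsx : 0 < s x := h.s_pos ⟨ha.trans_le hx.1, hx.2⟩
    have hsm : s x ^ (p - 1) ≤ s m ^ (p - 1) := Real.rpow_le_rpow hsx.le
      (h.strictMonoOn_s.monotoneOn hx0 (right_mem_Icc.2 hm0.le) hx.2) hp1.le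
    have hsxp : 0 < s x ^ (p - 1) := Real.rpow_pos_of_pos hsx _
    have hUx : s a ^ (p - 1) ≤ U x ^ (p - 1) := Real.rpow_le_rpow hsa.le (hUa x hx.1) hp1.le
    have hnum : -V' x ≤ |lam| * s m ^ (p - 1) + Q * η' x := by
      have h1 : lam * s x ^ (p - 1) * (1 - η x) ≤ |lam| * s m ^ (p - 1) * 1 := by
        have hη1x : 0 ≤ 1 - η x := by linarith [hηle x hx.2]
        calc lam * s x ^ (p - 1) * (1 - η x) ≤ |lam| * s x ^ (p - 1) * (1 - η x) := by
              gcongr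
              exact le_abs_self _
          _ ≤ |lam| * s m ^ (p - 1) * 1 := by
              refine mul_le_mul (by gcongr) (by linarith [hηnn x]) hη1x ?_
              exact mul_nonneg (abs_nonneg _) (hsxp.le.trans hsm)
      have h2 : c x ^ (p - 1) * η' x ≤ Q * η' x := by
        gcongr
      simp only [hV']
      linarith
    have hN : 0 ≤ |lam| * s m ^ (p - 1) + Q * η' x := by
      have : 0 ≤ Q := hcx.le.trans hQx
      have := hη'nn x
      have := hsxp.le.trans hsm
      positivity
    have hB' : B + Q / s a ^ (p - 1) * η' x
        = |lam| + (|lam| * s m ^ (p - 1) + Q * η' x) / s a ^ (p - 1) := by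
      rw [hB]; ring
    rw [hB']
    refine max_le ?_ (by positivity)
    simp only [hρ]
    rw [max_eq_left hx.1, sub_eq_add_neg, ← neg_div]
    refine add_le_add (neg_le_abs lam) ?_
    calc -V' x / U x ^ (p - 1) ≤ (|lam| * s m ^ (p - 1) + Q * η' x) / U x ^ (p - 1) := by
          gcongr
          exact Real.rpow_nonneg (hsa.le.trans (hUa x hx.1)) _
      _ ≤ _ := by gcongr
  have hint : ∫ x in a..m, (B + Q / s a ^ (p - 1) * η' x) = (m - a) * B + Q / s a ^ (p - 1) := by
    have hc : Continuous fun x => Q / s a ^ (p - 1) * η' x := continuous_const.mul hη'c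
    rw [intervalIntegral.integral_add intervalIntegrable_const
      (hc.intervalIntegrable _ _), intervalIntegral.integral_const,
      intervalIntegral.integral_const_mul,
      intervalIntegral.integral_eq_sub_of_hasDerivAt (fun x _ => hηd x)
        (hη'c.intervalIntegrable _ _), hη0 a le_rfl, smul_eq_mul]
    have : η m = 1 := le_antisymm (hηle m le_rfl) (hηm m le_rfl)
    rw [this]; ring
  rw [← hint]
  refine intervalIntegral.integral_mono_on ham.le (ContinuousOn.intervalIntegrable (by
      rw [uIcc_of_le ham.le]; exact hρpc.mono (Icc_subset_Icc ha.le le_rfl)))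
    ((continuous_const.add (continuous_const.mul hη'c)).intervalIntegrable _ _) hbound

/-- As `a` tends to the midpoint the term with factor `m - a` disappears, leaving the ratio of flux
to `s^(p-1)` there. -/
theorem exists_potential_lt (hp : 1 < p) (hL : 0 < pip p)
    (h : IsHalfSolution p lam (pip p / 2) s c) {ε : ℝ} (hε : 0 < ε) :
    ∃ r : ℝ → ℝ, ContinuousOn r (Icc 0 (pip p)) ∧ HasNontrivialSolution p lam r ∧
      normPosPart p r < 2 * (c (pip p / 2) / s (pip p / 2)) ^ (p - 1) + ε := by
  have hp1 : 0 < p - 1 := by linarith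
  set m := pip p / 2 with hm
  have hm0 : 0 < m := by positivity
  have hmI : m ∈ Icc 0 m := right_mem_Icc.2 hm0.le
  have hsm : 0 < s m := h.s_pos ⟨hm0, le_rfl⟩
  have hsp : 0 < s m ^ (p - 1) := Real.rpow_pos_of_pos hsm _
  -- `Q` must dominate `c^(p-1)` near `m`. Its slack costs `ε/4` after division by `s m ^ (p-1)`,
  -- the choice of `a` another `ε/4`, and reflection doubles both.
  set Q := c m ^ (p - 1) + ε / 4 * s m ^ (p - 1) with hQ
  have hcQ : c m ^ (p - 1) < Q := by rw [hQ]; linarith [mul_pos (by positivity : 0 < ε / 4) hsp]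
  have hcc : ContinuousWithinAt (fun x => c x ^ (p - 1)) (Icc 0 m) m :=
    (h.continuousOn_c m hmI).rpow_const (Or.inr hp1.le)
  obtain ⟨δ, hδ, hδQ⟩ := Metric.mem_nhdsWithin_iff.1 (hcc.eventually_lt_const hcQ)
  have hle : 𝓝[<] m ≤ 𝓝[Icc 0 m] m := by
    rw [← nhdsWithin_Ico_eq_nhdsLT hm0]
    exact nhdsWithin_mono _ Ico_subset_Icc_self
  have hsc : Tendsto (fun a => s a ^ (p - 1)) (𝓝[<] m) (𝓝 (s m ^ (p - 1))) :=
    (((h.continuousOn_s m hmI).rpow_const (Or.inr hp1.le)).tendsto.mono_left hle)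
  have hlim : Tendsto (fun a => (m - a) *
      (|lam| + |lam| * s m ^ (p - 1) / s a ^ (p - 1)) + Q / s a ^ (p - 1)) (𝓝[<] m)
      (𝓝 ((m - m) * (|lam| + |lam| * s m ^ (p - 1) / s m ^ (p - 1)) + Q / s m ^ (p - 1))) := by
    have h1 : Tendsto (fun a : ℝ => m - a) (𝓝[<] m) (𝓝 (m - m)) :=
      (tendsto_const_nhds.sub tendsto_id).mono_left nhdsWithin_le_nhds
    exact (h1.mul (tendsto_const_nhds.add (tendsto_const_nhds.div hsc hsp.ne'))).add
      (tendsto_const_nhds.div hsc hsp.ne')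
  have hval : (m - m) * (|lam| + |lam| * s m ^ (p - 1) / s m ^ (p - 1)) + Q / s m ^ (p - 1)
      < (c m / s m) ^ (p - 1) + ε / 2 := by
    rw [sub_self, zero_mul, zero_add, hQ, add_div, mul_div_assoc, div_self hsp.ne',
      Real.div_rpow (h.c_pos m hmI).le hsm.le]
    linarith
  have hev := hlim.eventually_lt_const hval
  have hI : ∀ᶠ a in 𝓝[<] m, a ∈ Ioo (max 0 (m - δ)) m :=
    Ioo_mem_nhdsLT (max_lt hm0 (by linarith))
  obtain ⟨a, ha1, ha2⟩ := (hev.and hI).exists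
  have ha0 : 0 < a := (le_max_left _ _).trans_lt ha2.1
  have haδ : m - δ < a := (le_max_right _ _).trans_lt ha2.1
  obtain ⟨r, hr, hsol, hn⟩ := h.exists_potential hp hL ha0 ha2.2 (Q := Q) fun x hx =>
    le_of_lt (hδQ ⟨by
      rw [Metric.mem_ball, Real.dist_eq, abs_lt]
      constructor <;> linarith [hx.1, hx.2], ha0.le.trans hx.1, hx.2⟩)
  exact ⟨r, hr, hsol, by simp only [← hm] at hn; linarith⟩

end IsHalfSolution

/-! ### The Riccati equation of a half solution -/

namespace IsHalfSolution

variable {p lam m : ℝ} {s c : ℝ → ℝ}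

theorem abs_riccati_rpow (hp : 1 < p) (h : IsHalfSolution p lam m s c) {x : ℝ} (hx : x ∈ Ioo 0 m) :
    |c x ^ (p - 1) / s x ^ (p - 1)| ^ (p / (p - 1)) = (c x / s x) ^ p := by
  have hp1 : p - 1 ≠ 0 := by linarith
  have hs := h.s_pos (Ioo_subset_Ioc_self hx)
  have hc := h.c_pos x (Ioo_subset_Icc_self hx)
  rw [← Real.div_rpow hc.le hs.le, abs_of_pos (by positivity),
    ← Real.rpow_mul (by positivity)]
  congr 1; field_simp

theorem hasDerivAt_riccati (hp : 1 < p) (h : IsHalfSolution p lam m s c) {x : ℝ}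
    (hx : x ∈ Ioo 0 m) :
    HasDerivAt (fun x => c x ^ (p - 1) / s x ^ (p - 1))
      (-lam - (p - 1) * |c x ^ (p - 1) / s x ^ (p - 1)| ^ (p / (p - 1))) x := by
  have hs := h.s_pos (Ioo_subset_Ioc_self hx)
  have hc := h.c_pos x (Ioo_subset_Icc_self hx)
  have h1 := (h.hasDerivAt_s x hx).rpow_const (p := p - 1) (Or.inl hs.ne')
  have hsp : 0 < s x ^ (p - 1) := by positivity
  refine ((h.hasDerivAt_c x hx).div h1 hsp.ne').congr_deriv ?_
  rw [h.abs_riccati_rpow hp hx, Real.div_rpow hc.le hs.le]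
  have e1 : s x ^ p = s x ^ (p - 1) * s x := by rw [← Real.rpow_add_one hs.ne']; congr 1; ring
  have e2 : c x ^ p = c x ^ (p - 1) * c x := by rw [← Real.rpow_add_one hc.ne']; congr 1; ring
  have e3 : s x ^ (p - 1) = s x ^ (p - 1 - 1) * s x := by
    rw [← Real.rpow_add_one hs.ne']; congr 1; ring
  have h2 : 0 < s x ^ (p - 1 - 1) := by positivity
  rw [e1, e2, e3]
  field_simp

theorem mono (h : IsHalfSolution p lam m s c) {m' : ℝ} (hm : m' ≤ m) :
    IsHalfSolution p lam m' s c where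
  continuousOn_s := h.continuousOn_s.mono (Icc_subset_Icc le_rfl hm)
  s_zero := h.s_zero
  hasDerivAt_s := fun x hx => h.hasDerivAt_s x ⟨hx.1, hx.2.trans_le hm⟩
  continuousOn_c := h.continuousOn_c.mono (Icc_subset_Icc le_rfl hm)
  c_pos := fun x hx => h.c_pos x ⟨hx.1, hx.2.trans hm⟩
  hasDerivAt_c := fun x hx => h.hasDerivAt_c x ⟨hx.1, hx.2.trans_le hm⟩

/-- The flux scales by `k^(p-1)` and its derivative by one more `k`. General nonzero `lam` thereby
reduces to `±(p-1)`. -/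
theorem comp_mul (h : IsHalfSolution p lam m s c) {k m' : ℝ} (hk : 0 < k) (hm : k * m' = m) :
    IsHalfSolution p (lam * k ^ p) m' (fun x => s (k * x)) fun x => k * c (k * x) := by
  subst hm
  have hmap : MapsTo (fun x => k * x) (Icc 0 m') (Icc 0 (k * m')) := fun x hx =>
    ⟨mul_nonneg hk.le hx.1, mul_le_mul_of_nonneg_left hx.2 hk.le⟩
  have hmap' : ∀ x ∈ Ioo 0 m', k * x ∈ Ioo 0 (k * m') := fun x hx =>
    ⟨mul_pos hk hx.1, mul_lt_mul_of_pos_left hx.2 hk⟩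
  have hd : ∀ x, HasDerivAt (fun x => k * x) k x := fun x => by
    simpa using (hasDerivAt_id x).const_mul k
  refine ⟨h.continuousOn_s.comp (by fun_prop) hmap, by simp [h.s_zero], fun x hx => ?_,
    continuousOn_const.mul (h.continuousOn_c.comp (by fun_prop) hmap),
    fun x hx => mul_pos hk (h.c_pos _ (hmap hx)), fun x hx => ?_⟩
  · exact ((h.hasDerivAt_s _ (hmap' x hx)).comp x (hd x)).congr_deriv (mul_comm _ _)
  · have h1 := ((h.hasDerivAt_c _ (hmap' x hx)).comp x (hd x)).const_mul (k ^ (p - 1))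
    refine (h1.congr_of_eventuallyEq ?_).congr_deriv ?_
    · filter_upwards [Ioo_mem_nhds hx.1 hx.2] with y hy
      exact Real.mul_rpow hk.le (h.c_pos _ (hmap (Ioo_subset_Icc_self hy))).le
    · have : k ^ p = k ^ (p - 1) * k := by rw [← Real.rpow_add_one hk.ne']; congr 1; ring
      rw [this]; ring

end IsHalfSolution

/-- Odd reflection about a zero of a solution of the Riccati equation. -/
theorem hasDerivAt_riccati_reflect {p lam T : ℝ} (hp : 1 < p) (hT : 0 < T) {w : ℝ → ℝ}
    (hw : ∀ x ∈ Ioo 0 T, HasDerivAt w (-lam - (p - 1) * |w x| ^ (p / (p - 1))) x)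
    (hwc : ContinuousWithinAt w (Iio T) T) (hwT : w T = 0) {W : ℝ → ℝ}
    (hW : W = fun x => if x ≤ T then w x else -w (2 * T - x)) :
    ∀ x ∈ Ioo 0 (2 * T), HasDerivAt W (-lam - (p - 1) * |W x| ^ (p / (p - 1))) x := by
  have hq : 0 < p / (p - 1) := div_pos (by linarith) (by linarith)
  have hrefl : ∀ x ∈ Ici T, W x = -w (2 * T - x) := fun x hx => by
    rcases (mem_Ici.1 hx).eq_or_lt with rfl | hlt
    · simp [hW, hwT, two_mul]
    · simp [hW, not_le.2 hlt]
  have hid : ∀ x ∈ Iic T, W x = w x := fun x hx => by simp [hW, mem_Iic.1 hx]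
  intro x hx
  rcases lt_trichotomy x T with hlt | rfl | hgt
  · rw [hid x hlt.le]
    refine (hw x ⟨hx.1, hlt⟩).congr_of_eventuallyEq ?_
    filter_upwards [Iio_mem_nhds hlt] with y hy using hid y (Iio_subset_Iic_self hy)
  -- At the junction both one-sided derivatives equal `-lam`: the left one is the limit of `w'` as
  -- `w → 0`, the right one follows by reflection.
  · have hlim : Tendsto (fun y => deriv w y) (𝓝[<] x) (𝓝 (-lam)) := by
      have h1 : Tendsto (fun y => -lam - (p - 1) * |w y| ^ (p / (p - 1))) (𝓝[<] x)
          (𝓝 (-lam - (p - 1) * |w x| ^ (p / (p - 1)))) :=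
        tendsto_const_nhds.sub (tendsto_const_nhds.mul (hwc.tendsto.abs.rpow_const (Or.inr hq.le)))
      rw [hwT, abs_zero, Real.zero_rpow hq.ne', mul_zero, sub_zero] at h1
      refine h1.congr' ?_
      filter_upwards [Ioo_mem_nhdsLT hT] with y hy using (hw y hy).deriv.symm
    have hl : HasDerivWithinAt w (-lam) (Iic x) x :=
      hasDerivWithinAt_Iic_of_tendsto_deriv
        (fun y hy => (hw y hy).differentiableAt.differentiableWithinAt)
        (hwc.mono Ioo_subset_Iio_self) (Ioo_mem_nhdsLT hT) hlim
    have hr : HasDerivWithinAt (fun y => -w (2 * x - y)) (-lam) (Ici x) x := by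
      have h2 : HasDerivWithinAt (fun y : ℝ => 2 * x - y) (-1) (Ici x) x :=
        ((hasDerivAt_id x).const_sub (2 * x)).hasDerivWithinAt
      have h3 : HasDerivWithinAt w (-lam) (Iic x) (2 * x - x) := by
        rwa [show 2 * x - x = x by ring]
      have h4 := (h3.comp x h2 fun y (hy : x ≤ y) => by
        change 2 * x - y ≤ x; linarith).neg
      exact h4.congr_deriv (by ring)
    have hWx : W x = 0 := by rw [hid x self_mem_Iic, hwT]
    rw [hWx, abs_zero, Real.zero_rpow hq.ne', mul_zero, sub_zero, ← hasDerivWithinAt_univ,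
      ← Iic_union_Ici (a := x)]
    exact (hl.congr hid (hid x self_mem_Iic)).union (hr.congr hrefl (hrefl x self_mem_Ici))
  · rw [hrefl x hgt.le, abs_neg]
    have h1 := hw (2 * T - x) ⟨by linarith [hx.2], by linarith⟩
    have h2 := (h1.comp x ((hasDerivAt_id x).const_sub (2 * T))).neg
    refine (h2.congr_of_eventuallyEq ?_).congr_deriv (by ring)
    filter_upwards [Ioi_mem_nhds hgt] with y hy using hrefl y (Ioi_subset_Ici_self hy)

/-! ### Inverse functions -/

/-- A strictly monotone map is an order isomorphism onto its image; domain and image being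
order-connected, order isomorphisms between them are continuous. -/
theorem continuousOn_invFunOn {F : ℝ → ℝ} {D : Set ℝ} (hD : D.OrdConnected)
    (hF : StrictMonoOn F D) (hc : ContinuousOn F D) :
    ContinuousOn (Function.invFunOn F D) (F '' D) := by
  have hE : (F '' D).OrdConnected := (hD.isPreconnected.image F hc).ordConnected
  rw [continuousOn_iff_continuous_domRestrict]
  have h1 : (F '' D).domRestrict (Function.invFunOn F D)
      = fun y => ((hF.orderIso F D).symm y : ℝ) := by
    ext y
    obtain ⟨x, rfl⟩ := (hF.orderIso F D).surjective y
    rw [OrderIso.symm_apply_apply]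
    exact hF.injOn.leftInvOn_invFunOn x.2
  rw [h1]
  exact continuous_subtype_val.comp (hF.orderIso F D).symm.continuous

theorem hasDerivAt_invFunOn {F : ℝ → ℝ} {D : Set ℝ} (hD : D.OrdConnected)
    (hF : StrictMonoOn F D) (hc : ContinuousOn F D) {y f' : ℝ} (hy : F '' D ∈ 𝓝 y) (hf' : f' ≠ 0)
    (hd : HasDerivAt F f' (Function.invFunOn F D y)) :
    HasDerivAt (Function.invFunOn F D) f'⁻¹ y :=
  HasDerivAt.of_local_left_inverse ((continuousOn_invFunOn hD hF hc).continuousAt hy) hd hf'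
    (by filter_upwards [hy] with z hz using Function.invFunOn_eq hz)

/-- The flux is `(1 - σ S^p)^((p-1)/p)`, and in its derivative the factor `S'` cancels the remaining
power. `σ = 1` is the sine, `σ = -1` the hyperbolic sine. -/
theorem hasDerivAt_rpow_pythagoras {p σ : ℝ} (hp : 1 < p) {S : ℝ → ℝ} {y : ℝ}
    (hd : HasDerivAt S ((1 - σ * S y ^ p) ^ (1 / p)) y) (hS : 0 < S y)
    (hC : 0 < 1 - σ * S y ^ p) :
    HasDerivAt (fun y => ((1 - σ * S y ^ p) ^ (1 / p)) ^ (p - 1))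
      (-(σ * (p - 1)) * S y ^ (p - 1)) y := by
  have hp0 : 0 < p := by linarith
  have h1 := (((hd.rpow_const (p := p) (Or.inl hS.ne')).const_mul σ).const_sub 1)
  have h2 := h1.rpow_const (p := (p - 1) / p) (Or.inl hC.ne')
  refine (h2.congr_of_eventuallyEq ?_).congr_deriv ?_
  · filter_upwards [h1.continuousAt.eventually_const_lt hC] with z hz
    rw [← Real.rpow_mul hz.le]
    congr 1; field_simp
  · have e : (1 - σ * S y ^ p) ^ (1 / p) * (1 - σ * S y ^ p) ^ ((p - 1) / p - 1) = 1 := by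
      rw [← Real.rpow_add hC]
      have : 1 / p + ((p - 1) / p - 1) = 0 := by field_simp; ring
      rw [this, Real.rpow_zero]
    calc _ = -(σ * (p - 1)) * S y ^ (p - 1) *
          ((1 - σ * S y ^ p) ^ (1 / p) * (1 - σ * S y ^ p) ^ ((p - 1) / p - 1)) := by
            field_simp
      _ = _ := by rw [e, mul_one]

/-! ### The function `sin_p` -/

section Sine

variable {p : ℝ}

theorem rpow_lt_one_of_mem_Ico (hp : 1 < p) {t : ℝ} (ht : t ∈ Ico 0 1) : 0 < 1 - t ^ p := by
  have := Real.rpow_lt_one ht.1 ht.2 (by linarith : 0 < p)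
  linarith

/-- Since `t^p ≤ t` on `[0, 1]`, the integrand is dominated by `(1 - t)^(-1/p)`, integrable because
`1/p < 1`. -/
theorem intervalIntegrable_arcsinp (hp : 1 < p) :
    IntervalIntegrable (fun t : ℝ => 1 / (1 - t ^ p) ^ (1 / p)) volume 0 1 := by
  have hp0 : 0 < p := by linarith
  have h1p : 1 / p < 1 := (div_lt_one hp0).2 hp
  have hg : IntervalIntegrable (fun t : ℝ => (1 - t) ^ (-(1 / p))) volume 0 1 := by
    have := ((intervalIntegral.intervalIntegrable_rpow' (a := 0) (b := 1)
      (by linarith : -1 < -(1 / p))).comp_sub_left 1).symm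
    simpa using this
  refine hg.mono_fun (Measurable.aestronglyMeasurable (by fun_prop)) ?_
  rw [uIoc_of_le zero_le_one]
  filter_upwards [ae_restrict_mem measurableSet_Ioc,
    ae_restrict_of_ae (Measure.ae_ne volume (1 : ℝ))] with t ht ht1
  have htI : t ∈ Ico 0 1 := ⟨ht.1.le, lt_of_le_of_ne ht.2 ht1⟩
  have h1 := rpow_lt_one_of_mem_Ico hp htI
  have h2 : 0 < 1 - t := by linarith [htI.2]
  have h3 : t ^ p ≤ t := by
    simpa using Real.rpow_le_rpow_of_exponent_ge ht.1 ht.2 hp.le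
  rw [Real.norm_of_nonneg (by positivity), Real.norm_of_nonneg (by positivity),
    Real.rpow_neg h2.le, ← one_div]
  exact one_div_le_one_div_of_le (by positivity)
    (Real.rpow_le_rpow h2.le (by linarith) (by positivity))

theorem continuousOn_arcsinp (hp : 1 < p) : ContinuousOn (arcsinp p) (Icc 0 1) := by
  have := intervalIntegral.continuousOn_primitive_interval' (intervalIntegrable_arcsinp hp)
    left_mem_uIcc
  rwa [uIcc_of_le zero_le_one] at this

theorem hasDerivAt_arcsinp (hp : 1 < p) {x : ℝ} (hx : x ∈ Ioo 0 1) :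
    HasDerivAt (arcsinp p) (1 / (1 - x ^ p) ^ (1 / p)) x := by
  have h1 := rpow_lt_one_of_mem_Ico hp (Ioo_subset_Ico_self hx)
  refine intervalIntegral.integral_hasDerivAt_right
    ((intervalIntegrable_arcsinp hp).mono_set ?_)
    (Measurable.stronglyMeasurable (by fun_prop)).stronglyMeasurableAtFilter ?_
  · rw [uIcc_of_le hx.1.le, uIcc_of_le zero_le_one]; exact Icc_subset_Icc le_rfl hx.2.le
  · refine ContinuousAt.div continuousAt_const ?_ (Real.rpow_pos_of_pos h1 _).ne'
    exact (continuousAt_const.sub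
      (Real.continuousAt_rpow_const _ _ (Or.inl hx.1.ne'))).rpow_const (Or.inl h1.ne')

theorem strictMonoOn_arcsinp (hp : 1 < p) : StrictMonoOn (arcsinp p) (Icc 0 1) := by
  refine strictMonoOn_of_deriv_pos (convex_Icc _ _) (continuousOn_arcsinp hp) fun x hx => ?_
  rw [interior_Icc] at hx
  have h1 := rpow_lt_one_of_mem_Ico hp (Ioo_subset_Ico_self hx)
  rw [(hasDerivAt_arcsinp hp hx).deriv]
  positivity

theorem arcsinp_zero : arcsinp p 0 = 0 := by simp [arcsinp]

theorem arcsinp_one : arcsinp p 1 = pip p / 2 := by simp [pip]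

theorem pip_pos (hp : 1 < p) : 0 < pip p := by
  have := strictMonoOn_arcsinp hp (left_mem_Icc.2 zero_le_one) (right_mem_Icc.2 zero_le_one)
    zero_lt_one
  rw [arcsinp_zero, arcsinp_one] at this
  linarith

theorem image_arcsinp (hp : 1 < p) : arcsinp p '' Icc 0 1 = Icc 0 (pip p / 2) := by
  have h : arcsinp p '' Icc 0 1 = Icc (arcsinp p 0) (arcsinp p 1) :=
    Subset.antisymm (strictMonoOn_arcsinp hp).monotoneOn.image_Icc_subset
      (intermediate_value_Icc zero_le_one (continuousOn_arcsinp hp))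
  rwa [arcsinp_zero, arcsinp_one] at h

theorem sinpBase_mem (hp : 1 < p) {y : ℝ} (hy : y ∈ Icc 0 (pip p / 2)) :
    sinpBase p y ∈ Icc 0 1 :=
  Function.invFunOn_mem (by rwa [← image_arcsinp hp] at hy)

theorem arcsinp_sinpBase (hp : 1 < p) {y : ℝ} (hy : y ∈ Icc 0 (pip p / 2)) :
    arcsinp p (sinpBase p y) = y :=
  Function.invFunOn_eq (by rwa [← image_arcsinp hp] at hy)

theorem sinpBase_arcsinp (hp : 1 < p) {x : ℝ} (hx : x ∈ Icc 0 1) :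
    sinpBase p (arcsinp p x) = x :=
  (strictMonoOn_arcsinp hp).injOn.leftInvOn_invFunOn hx

theorem sinpBase_zero (hp : 1 < p) : sinpBase p 0 = 0 := by
  have := sinpBase_arcsinp hp (left_mem_Icc.2 zero_le_one)
  rwa [arcsinp_zero] at this

theorem sinpBase_pip_div_two (hp : 1 < p) : sinpBase p (pip p / 2) = 1 := by
  have := sinpBase_arcsinp hp (right_mem_Icc.2 zero_le_one)
  rwa [arcsinp_one] at this

theorem sinpBase_lt_one (hp : 1 < p) {y : ℝ} (hy : y ∈ Ico 0 (pip p / 2)) :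
    sinpBase p y < 1 := by
  refine lt_of_le_of_ne (sinpBase_mem hp (Ico_subset_Icc_self hy)).2 fun h => hy.2.ne ?_
  rw [← arcsinp_sinpBase hp (Ico_subset_Icc_self hy), h, arcsinp_one]

theorem sinpBase_pos (hp : 1 < p) {y : ℝ} (hy : y ∈ Ioc 0 (pip p / 2)) : 0 < sinpBase p y := by
  refine lt_of_le_of_ne (sinpBase_mem hp (Ioc_subset_Icc_self hy)).1 fun h => hy.1.ne ?_
  rw [← arcsinp_sinpBase hp (Ioc_subset_Icc_self hy), ← h, arcsinp_zero]

theorem continuousOn_sinpBase (hp : 1 < p) :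
    ContinuousOn (sinpBase p) (Icc 0 (pip p / 2)) := by
  rw [← image_arcsinp hp]
  exact continuousOn_invFunOn ordConnected_Icc (strictMonoOn_arcsinp hp) (continuousOn_arcsinp hp)

theorem hasDerivAt_sinpBase (hp : 1 < p) {y : ℝ} (hy : y ∈ Ioo 0 (pip p / 2)) :
    HasDerivAt (sinpBase p) ((1 - sinpBase p y ^ p) ^ (1 / p)) y := by
  have hs : sinpBase p y ∈ Ioo 0 1 :=
    ⟨sinpBase_pos hp (Ioo_subset_Ioc_self hy), sinpBase_lt_one hp (Ioo_subset_Ico_self hy)⟩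
  have h1 := rpow_lt_one_of_mem_Ico hp (Ioo_subset_Ico_self hs)
  refine (hasDerivAt_invFunOn ordConnected_Icc (strictMonoOn_arcsinp hp) (continuousOn_arcsinp hp)
    ?_ ?_ (hasDerivAt_arcsinp hp hs)).congr_deriv (by rw [one_div, inv_inv, sinpBase])
  · rw [image_arcsinp hp]; exact Icc_mem_nhds hy.1 hy.2
  · positivity

/-- The interval stops short of `pip p / 2`, where the derivative vanishes. -/
theorem isHalfSolution_sinpBase (hp : 1 < p) {M : ℝ} (hM : M < pip p / 2) :
    IsHalfSolution p (p - 1) M (sinpBase p) fun y => (1 - sinpBase p y ^ p) ^ (1 / p) := by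
  have hp0 : 0 < p := by linarith
  have hsub : Icc 0 M ⊆ Icc 0 (pip p / 2) := Icc_subset_Icc le_rfl hM.le
  have hC : ∀ y ∈ Icc 0 M, 0 < 1 - sinpBase p y ^ p := fun y hy =>
    rpow_lt_one_of_mem_Ico hp ⟨(sinpBase_mem hp (hsub hy)).1,
      sinpBase_lt_one hp ⟨hy.1, hy.2.trans_lt hM⟩⟩
  have hc := (continuousOn_sinpBase hp).mono hsub
  refine ⟨hc, sinpBase_zero hp, fun y hy => hasDerivAt_sinpBase hp ⟨hy.1, hy.2.trans hM⟩,
    (continuousOn_const.sub (hc.rpow_const fun _ _ => Or.inr hp0.le)).rpow_const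
      fun y hy => Or.inl (hC y hy).ne',
    fun y hy => Real.rpow_pos_of_pos (hC y hy) _, fun y hy => ?_⟩
  have := hasDerivAt_rpow_pythagoras (σ := 1) hp
    (by simpa only [one_mul] using hasDerivAt_sinpBase hp ⟨hy.1, hy.2.trans hM⟩)
    (sinpBase_pos hp ⟨hy.1, (hy.2.trans hM).le⟩)
    (by simpa only [one_mul] using hC y (Ioo_subset_Icc_self hy))
  simpa only [one_mul] using this

theorem sinp_eq_sinpBase (hp : 1 < p) {y : ℝ} (hy : y ∈ Ioo 0 (pip p / 2)) :
    sinp p y = sinpBase p y := by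
  have hL := pip_pos hp
  have hr : redp p y = y := by
    have : round (y / (2 * pip p)) = 0 := by
      rw [round_eq_zero_iff]
      refine ⟨?_, ?_⟩
      · have : 0 < y / (2 * pip p) := div_pos hy.1 (by positivity)
        linarith
      · rw [div_lt_iff₀ (by positivity)]; linarith [hy.2]
    simp [redp, this]
  rw [sinp, hr, Real.sign_of_pos hy.1, abs_of_pos hy.1, min_eq_left (by linarith [hy.2]), one_mul]

theorem cotp_eq (hp : 1 < p) {y : ℝ} (hy : y ∈ Ioo 0 (pip p / 2)) :
    cotp p y = (1 - sinpBase p y ^ p) ^ (1 / p) / sinpBase p y := by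
  have h : sinp p =ᶠ[𝓝 y] sinpBase p := by
    filter_upwards [Ioo_mem_nhds hy.1 hy.2] with z hz using sinp_eq_sinpBase hp hz
  rw [cotp, cosp, h.deriv_eq, (hasDerivAt_sinpBase hp hy).deriv, sinp_eq_sinpBase hp hy]

end Sine

/-! ### The function `sinh_p` -/

section HyperbolicSine

variable {p : ℝ}

/-- The inverse of `arcsinh_p` on `[0, ∞)`. -/
def sinhpBase (p : ℝ) : ℝ → ℝ := Function.invFunOn (arcsinhp p) (Ici 0)

theorem continuous_arcsinhp_integrand (hp : 1 < p) :
    Continuous fun t : ℝ => 1 / (1 + max t 0 ^ p) ^ (1 / p) := by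
  have hp0 : 0 < p := by linarith
  have h0 : ∀ t : ℝ, 0 < 1 + max t 0 ^ p := fun t => by
    have := Real.rpow_nonneg (le_max_right t 0) p
    linarith
  refine continuous_const.div ((continuous_const.add
    ((continuous_id.max continuous_const).rpow_const fun _ => Or.inr hp0.le)).rpow_const
      fun t => Or.inl (h0 t).ne') fun t => (Real.rpow_pos_of_pos (h0 t) _).ne'

theorem arcsinhp_eq {x : ℝ} (hx : 0 ≤ x) :
    arcsinhp p x = ∫ t in 0..x, 1 / (1 + max t 0 ^ p) ^ (1 / p) := by
  refine intervalIntegral.integral_congr fun t ht => ?_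
  rw [uIcc_of_le hx] at ht
  simp only [max_eq_left ht.1]

theorem continuousOn_arcsinhp (hp : 1 < p) : ContinuousOn (arcsinhp p) (Ici 0) :=
  ContinuousOn.congr (continuous_iff_continuousAt.2 fun x =>
    (hasDerivAt_primitive (continuous_arcsinhp_integrand hp) x).continuousAt).continuousOn
    fun _ hx => arcsinhp_eq hx

theorem hasDerivAt_arcsinhp (hp : 1 < p) {x : ℝ} (hx : 0 < x) :
    HasDerivAt (arcsinhp p) (1 / (1 + x ^ p) ^ (1 / p)) x := by
  refine ((hasDerivAt_primitive (continuous_arcsinhp_integrand hp) x).congr_of_eventuallyEq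
    ?_).congr_deriv (by rw [max_eq_left hx.le])
  filter_upwards [Ioi_mem_nhds hx] with y hy using arcsinhp_eq (le_of_lt hy)

theorem strictMonoOn_arcsinhp (hp : 1 < p) : StrictMonoOn (arcsinhp p) (Ici 0) := by
  refine strictMonoOn_of_deriv_pos (convex_Ici _) (continuousOn_arcsinhp hp) fun x hx => ?_
  rw [interior_Ici] at hx
  have hx0 : 0 < x := hx
  rw [(hasDerivAt_arcsinhp hp hx).deriv]
  positivity

theorem arcsinhp_zero : arcsinhp p 0 = 0 := by simp [arcsinhp]

/-- From `1 + y^p ≤ (1 + y)^p`. It makes `arcsinhp` unbounded, hence onto `[0, ∞)`. -/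
theorem log_one_add_le_arcsinhp (hp : 1 < p) {x : ℝ} (hx : 0 ≤ x) :
    Real.log (1 + x) ≤ arcsinhp p x := by
  have hp0 : 0 < p := by linarith
  have hd : ∀ y : ℝ, 0 < y → HasDerivAt (fun y => arcsinhp p y - Real.log (1 + y))
      (1 / (1 + y ^ p) ^ (1 / p) - 1 / (1 + y)) y := fun y hy =>
    (hasDerivAt_arcsinhp hp hy).sub (((hasDerivAt_id y).const_add 1).log (by positivity))
  have hm : MonotoneOn (fun y => arcsinhp p y - Real.log (1 + y)) (Ici 0) := by
    refine monotoneOn_of_deriv_nonneg (convex_Ici _) ((continuousOn_arcsinhp hp).sub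
      (ContinuousOn.log (by fun_prop) fun y hy => ?_)) (fun y hy => ?_) fun y hy => ?_
    · have : (0 : ℝ) ≤ y := hy
      positivity
    · rw [interior_Ici] at hy; exact (hd y hy).differentiableAt.differentiableWithinAt
    · rw [interior_Ici] at hy
      have hy0 : 0 < y := hy
      rw [(hd y hy).deriv, sub_nonneg]
      refine one_div_le_one_div_of_le (by positivity) ?_
      have h1 : 1 + y ^ p ≤ (1 + y) ^ p := by
        simpa using Real.add_rpow_le_rpow_add zero_le_one hy0.le hp.le
      calc (1 + y ^ p) ^ (1 / p) ≤ ((1 + y) ^ p) ^ (1 / p) := by gcongr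
        _ = 1 + y := by rw [one_div, Real.rpow_rpow_inv (by positivity) hp0.ne']
  have := hm self_mem_Ici hx hx
  simp only [arcsinhp_zero, add_zero, Real.log_one, sub_zero] at this
  linarith

theorem image_arcsinhp (hp : 1 < p) : arcsinhp p '' Ici 0 = Ici 0 := by
  refine Subset.antisymm ?_ fun y hy => ?_
  · rintro _ ⟨x, hx, rfl⟩
    have := (strictMonoOn_arcsinhp hp).monotoneOn self_mem_Ici hx hx
    rwa [arcsinhp_zero] at this
  · have hy0 : (0 : ℝ) ≤ y := hy
    have hx : 0 ≤ Real.exp y - 1 := by linarith [Real.add_one_le_exp y]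
    have h1 := log_one_add_le_arcsinhp hp hx
    rw [add_sub_cancel, Real.log_exp] at h1
    obtain ⟨z, hz, hzy⟩ := intermediate_value_Icc hx
      ((continuousOn_arcsinhp hp).mono Icc_subset_Ici_self) ⟨by rwa [arcsinhp_zero], h1⟩
    exact ⟨z, hz.1, hzy⟩

theorem arcsinhp_sinhpBase (hp : 1 < p) {y : ℝ} (hy : 0 ≤ y) :
    arcsinhp p (sinhpBase p y) = y :=
  Function.invFunOn_eq (by
    have : y ∈ Ici (0 : ℝ) := hy
    rwa [← image_arcsinhp hp] at this)

theorem sinhpBase_nonneg (hp : 1 < p) {y : ℝ} (hy : 0 ≤ y) : 0 ≤ sinhpBase p y := by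
  have : y ∈ arcsinhp p '' Ici 0 := by rw [image_arcsinhp hp]; exact hy
  exact Function.invFunOn_mem this

theorem sinhpBase_zero (hp : 1 < p) : sinhpBase p 0 = 0 := by
  have := (strictMonoOn_arcsinhp hp).injOn.leftInvOn_invFunOn (self_mem_Ici (a := (0 : ℝ)))
  rwa [arcsinhp_zero] at this

theorem sinhpBase_pos (hp : 1 < p) {y : ℝ} (hy : 0 < y) : 0 < sinhpBase p y := by
  refine lt_of_le_of_ne (sinhpBase_nonneg hp hy.le) fun h => hy.ne ?_
  rw [← arcsinhp_sinhpBase hp hy.le, ← h, arcsinhp_zero]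

theorem continuousOn_sinhpBase (hp : 1 < p) : ContinuousOn (sinhpBase p) (Ici 0) := by
  have := continuousOn_invFunOn ordConnected_Ici (strictMonoOn_arcsinhp hp)
    (continuousOn_arcsinhp hp)
  rwa [image_arcsinhp hp] at this

theorem hasDerivAt_sinhpBase (hp : 1 < p) {y : ℝ} (hy : 0 < y) :
    HasDerivAt (sinhpBase p) ((1 + sinhpBase p y ^ p) ^ (1 / p)) y := by
  have hs := sinhpBase_pos hp hy
  refine (hasDerivAt_invFunOn ordConnected_Ici (strictMonoOn_arcsinhp hp)
    (continuousOn_arcsinhp hp) ?_ ?_ (hasDerivAt_arcsinhp hp hs)).congr_deriv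
      (by rw [one_div, inv_inv, sinhpBase])
  · rw [image_arcsinhp hp]; exact Ici_mem_nhds hy
  · positivity

theorem isHalfSolution_sinhpBase (hp : 1 < p) (M : ℝ) :
    IsHalfSolution p (-(p - 1)) M (sinhpBase p) fun y => (1 + sinhpBase p y ^ p) ^ (1 / p) := by
  have hp0 : 0 < p := by linarith
  have hC : ∀ y ∈ Icc 0 M, 0 < 1 + sinhpBase p y ^ p := fun y hy => by
    have := sinhpBase_nonneg hp hy.1
    positivity
  have hc := (continuousOn_sinhpBase hp).mono (Icc_subset_Ici_self : Icc 0 M ⊆ Ici 0)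
  refine ⟨hc, sinhpBase_zero hp, fun y hy => hasDerivAt_sinhpBase hp hy.1,
    (continuousOn_const.add (hc.rpow_const fun _ _ => Or.inr hp0.le)).rpow_const
      fun y hy => Or.inl (hC y hy).ne',
    fun y hy => Real.rpow_pos_of_pos (hC y hy) _, fun y hy => ?_⟩
  have := hasDerivAt_rpow_pythagoras (σ := -1) hp
    (by simpa only [neg_mul, one_mul, sub_neg_eq_add] using hasDerivAt_sinhpBase hp hy.1)
    (sinhpBase_pos hp hy.1)
    (by simpa only [neg_mul, one_mul, sub_neg_eq_add] using hC y (Ioo_subset_Icc_self hy))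
  simpa only [neg_mul, one_mul, sub_neg_eq_add] using this

theorem sinhp_eq_sinhpBase {y : ℝ} (hy : 0 < y) : sinhp p y = sinhpBase p y := by
  rw [sinhp, Real.sign_of_pos hy, abs_of_pos hy, one_mul, sinhpBase]

theorem cothp_eq (hp : 1 < p) {y : ℝ} (hy : 0 < y) :
    cothp p y = (1 + sinhpBase p y ^ p) ^ (1 / p) / sinhpBase p y := by
  have h : sinhp p =ᶠ[𝓝 y] sinhpBase p := by
    filter_upwards [Ioi_mem_nhds hy] with z hz using sinhp_eq_sinhpBase hz
  rw [cothp, coshp, h.deriv_eq, (hasDerivAt_sinhpBase hp hy).deriv, sinhp_eq_sinhpBase hy]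

end HyperbolicSine

/-! ### The Lyapunov inequality -/

/-- `C` is a strict and sharp lower bound for `‖r₊‖` among the potentials `r` for which the problem
has a nontrivial solution. -/
def SharpLyapunov (p lam C : ℝ) : Prop :=
  (∀ r : ℝ → ℝ, ContinuousOn r (Icc 0 (pip p)) → HasNontrivialSolution p lam r →
      C < normPosPart p r) ∧
    ∀ ε : ℝ, 0 < ε → ∃ r : ℝ → ℝ, ContinuousOn r (Icc 0 (pip p)) ∧
      HasNontrivialSolution p lam r ∧ |normPosPart p r - C| < ε

/-- `W` is kept separate from the half solution because the quotient `(c/s)^(p-1)` need not define a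
Riccati solution on the whole interval; agreement at the midpoint suffices. -/
theorem IsHalfSolution.sharpLyapunov {p lam : ℝ} (hp : 1 < p) {s c W : ℝ → ℝ}
    (h : IsHalfSolution p lam (pip p / 2) s c)
    (hW : ∀ x ∈ Ioo 0 (pip p), HasDerivAt W (-lam - (p - 1) * |W x| ^ (p / (p - 1))) x)
    (hneg : ∀ x ∈ Ioo 0 (pip p), -lam - (p - 1) * |W x| ^ (p / (p - 1)) < 0)
    (hWm : W (pip p / 2) = c (pip p / 2) ^ (p - 1) / s (pip p / 2) ^ (p - 1)) :
    SharpLyapunov p lam (2 * (c (pip p / 2) / s (pip p / 2)) ^ (p - 1)) := by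
  have hL := pip_pos hp
  have hm : 0 < pip p / 2 := by positivity
  have hs := h.s_pos (right_mem_Ioc.2 hm)
  have hc := h.c_pos _ (right_mem_Icc.2 hm.le)
  rw [← Real.div_rpow hc.le hs.le] at hWm
  have hpos : 0 < W (pip p / 2) := by rw [hWm]; positivity
  have hlow : ∀ r : ℝ → ℝ, ContinuousOn r (Icc 0 (pip p)) → HasNontrivialSolution p lam r →
      2 * (c (pip p / 2) / s (pip p / 2)) ^ (p - 1) < normPosPart p r := fun r hr hsol => by
    rw [← hWm]
    exact two_mul_riccati_lt_normPosPart hp hL hW hneg hpos hr hsol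
  refine ⟨hlow, fun ε hε => ?_⟩
  obtain ⟨r, hr, hsol, hlt⟩ := h.exists_potential_lt hp hL hε
  have := hlow r hr hsol
  exact ⟨r, hr, hsol, by rw [abs_lt]; constructor <;> linarith⟩

theorem IsHalfSolution.sharpLyapunov_of_nonpos {p lam : ℝ} (hp : 1 < p) {s c : ℝ → ℝ}
    (h : IsHalfSolution p lam (pip p) s c)
    (hneg : ∀ x ∈ Ioo 0 (pip p), -lam < (p - 1) * (c x / s x) ^ p) :
    SharpLyapunov p lam (2 * (c (pip p / 2) / s (pip p / 2)) ^ (p - 1)) :=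
  (h.mono (by linarith [pip_pos hp])).sharpLyapunov hp (fun _ hx => h.hasDerivAt_riccati hp hx)
    (fun x hx => by rw [h.abs_riccati_rpow hp hx]; linarith [hneg x hx]) rfl

theorem sharpLyapunov_zero {p : ℝ} (hp : 1 < p) :
    SharpLyapunov p 0 (2 ^ p / pip p ^ (p - 1)) := by
  have hL := pip_pos hp
  have h : IsHalfSolution p 0 (pip p) (fun x => x) fun _ => 1 :=
    ⟨continuousOn_id, rfl, fun x _ => hasDerivAt_id x, continuousOn_const, fun _ _ => one_pos,
      fun x _ => by simpa using hasDerivAt_const x (1 : ℝ)⟩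
  have := h.sharpLyapunov_of_nonpos hp fun x hx => by
    have := hx.1
    have : 0 < p - 1 := by linarith
    rw [neg_zero]; positivity
  have e : 2 ^ p / pip p ^ (p - 1) = 2 * (1 / (pip p / 2)) ^ (p - 1) := by
    have e2 : (2 : ℝ) ^ p = 2 ^ (p - 1) * 2 := by
      rw [← Real.rpow_add_one two_ne_zero]; congr 1; ring
    rw [one_div_div, Real.div_rpow zero_le_two hL.le, e2]; ring
  rwa [e]

theorem sharpLyapunov_neg {p lam : ℝ} (hp : 1 < p) (hlam : lam < 0) :
    SharpLyapunov p lam (2 * (-lam / (p - 1)) ^ ((p - 1) / p) *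
      cothp p (pip p / 2 * (-lam / (p - 1)) ^ (1 / p)) ^ (p - 1)) := by
  have hL := pip_pos hp
  have hp0 : 0 < p := by linarith
  have hp1 : 0 < p - 1 := by linarith
  have hq : 0 < -lam / (p - 1) := div_pos (by linarith) hp1
  set k := (-lam / (p - 1)) ^ (1 / p) with hk
  have hk0 : 0 < k := by positivity
  have hkp : k ^ p = -lam / (p - 1) := by rw [hk, one_div, Real.rpow_inv_rpow hq.le hp0.ne']
  have hkl : -(p - 1) * k ^ p = lam := by rw [hkp]; field_simp
  have hkp1 : (-lam / (p - 1)) ^ ((p - 1) / p) = k ^ (p - 1) := by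
    rw [hk, ← Real.rpow_mul hq.le]; congr 1; ring
  have h := (isHalfSolution_sinhpBase hp (k * pip p)).comp_mul hk0 rfl
  rw [hkl] at h
  -- The Riccati slope is negative because `cosh_p^p = 1 + sinh_p^p > sinh_p^p`.
  have hsharp := h.sharpLyapunov_of_nonpos hp fun x hx => by
    have hs := sinhpBase_pos hp (mul_pos hk0 hx.1)
    set S := sinhpBase p (k * x)
    have hS : 0 < S ^ p := by positivity
    rw [Real.div_rpow (by positivity) hs.le, Real.mul_rpow hk0.le (by positivity), one_div,
      Real.rpow_inv_rpow (by positivity) hp0.ne', ← hkl, neg_mul, neg_neg, ← mul_div_assoc,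
      lt_div_iff₀ hS, ← mul_assoc]
    have : 0 < (p - 1) * k ^ p := by positivity
    nlinarith
  have hm : 0 < k * (pip p / 2) := by positivity
  rw [mul_comm (pip p / 2), cothp_eq hp hm, hkp1, mul_assoc, ← Real.mul_rpow hk0.le
    (div_nonneg (Real.rpow_nonneg (by have := sinhpBase_pos hp hm; positivity) _)
      (sinhpBase_nonneg hp hm.le)), ← mul_div_assoc]
  exact hsharp

theorem sharpLyapunov_pos {p lam : ℝ} (hp : 1 < p) (hlam0 : 0 < lam) (hlam : lam < p - 1) :
    SharpLyapunov p lam (2 * (lam / (p - 1)) ^ ((p - 1) / p) *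
      cotp p (pip p / 2 * (lam / (p - 1)) ^ (1 / p)) ^ (p - 1)) := by
  have hL := pip_pos hp
  have hp0 : 0 < p := by linarith
  have hp1 : 0 < p - 1 := by linarith
  have hq : 0 < lam / (p - 1) := div_pos hlam0 hp1
  set k := (lam / (p - 1)) ^ (1 / p) with hk
  have hk0 : 0 < k := by positivity
  have hk1 : k < 1 := Real.rpow_lt_one hq.le ((div_lt_one hp1).2 hlam) (by positivity)
  have hkp : k ^ p = lam / (p - 1) := by rw [hk, one_div, Real.rpow_inv_rpow hq.le hp0.ne']
  have hkl : (p - 1) * k ^ p = lam := by rw [hkp]; field_simp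
  have hkp1 : (lam / (p - 1)) ^ ((p - 1) / p) = k ^ (p - 1) := by
    rw [hk, ← Real.rpow_mul hq.le]; congr 1; ring
  have hm0 : 0 < pip p / 2 := by positivity
  have hhalf : ∀ m, k * m < pip p / 2 → IsHalfSolution p lam m (fun x => sinpBase p (k * x))
      fun x => k * (1 - sinpBase p (k * x) ^ p) ^ (1 / p) := fun m hm => by
    have := (isHalfSolution_sinpBase hp hm).comp_mul hk0 rfl
    rwa [hkl] at this
  set s : ℝ → ℝ := fun x => sinpBase p (k * x) with hs
  set c : ℝ → ℝ := fun x => k * (1 - sinpBase p (k * x) ^ p) ^ (1 / p) with hc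
  set w : ℝ → ℝ := fun x => c x ^ (p - 1) / s x ^ (p - 1) with hw
  -- `T` is where the derivative of `sin_p(kx)` first vanishes. It may lie before `pip p`, but `k <
  -- 1` gives `T > pip p / 2`, so odd reflection of `w` about `T` covers `(0, pip p)`.
  set T := pip p / 2 / k with hT
  have hT0 : 0 < T := by positivity
  have hkT : k * T = pip p / 2 := by rw [hT]; field_simp
  have hmT : pip p / 2 < T := by rw [hT, lt_div_iff₀ hk0]; nlinarith
  have hwd : ∀ x ∈ Ioo 0 T, HasDerivAt w (-lam - (p - 1) * |w x| ^ (p / (p - 1))) x := by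
    intro x hx
    obtain ⟨m, hxm, hmT⟩ := exists_between hx.2
    have hkm : k * m < pip p / 2 := by rw [← hkT]; gcongr
    exact (hhalf m hkm).hasDerivAt_riccati hp ⟨hx.1, hxm⟩
  have hsT : s T = 1 := by simp only [hs, hkT, sinpBase_pip_div_two hp]
  have hcT : c T = 0 := by
    simp only [hc, hkT, sinpBase_pip_div_two hp, Real.one_rpow, sub_self]
    rw [Real.zero_rpow (by positivity), mul_zero]
  have hwT : w T = 0 := by simp only [hw, hcT, Real.zero_rpow hp1.ne', zero_div]
  have hwc : ContinuousWithinAt w (Iio T) T := by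
    have hsc : ContinuousWithinAt s (Icc 0 T) T := by
      refine ((continuousOn_sinpBase hp).comp (by fun_prop) fun x hx => ?_) T
        (right_mem_Icc.2 hT0.le)
      exact ⟨mul_nonneg hk0.le hx.1, by rw [← hkT]; gcongr; exact hx.2⟩
    have hcc : ContinuousWithinAt c (Icc 0 T) T :=
      continuousWithinAt_const.mul ((continuousWithinAt_const.sub
        (hsc.rpow_const (Or.inr hp0.le))).rpow_const (Or.inr (by positivity)))
    have hwc' : ContinuousWithinAt w (Icc 0 T) T :=
      (hcc.rpow_const (Or.inr hp1.le)).div (hsc.rpow_const (Or.inr hp1.le)) (by simp [hsT])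
    exact hwc'.mono_of_mem_nhdsWithin
      (mem_of_superset (Ioo_mem_nhdsLT hT0) Ioo_subset_Icc_self)
  have hW := hasDerivAt_riccati_reflect hp hT0 hwd hwc hwT rfl
  have hkm : k * (pip p / 2) < pip p / 2 := by nlinarith
  have hsharp := (hhalf (pip p / 2) hkm).sharpLyapunov hp
    (fun x hx => hW x ⟨hx.1, by linarith [hx.2]⟩)
    (fun x _ => by
      have := mul_nonneg hp1.le (Real.rpow_nonneg
        (abs_nonneg ((fun x => if x ≤ T then w x else -w (2 * T - x)) x)) (p / (p - 1)))
      linarith) (by simp only [if_pos hmT.le, hw])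
  have hkmI : k * (pip p / 2) ∈ Ioo 0 (pip p / 2) := ⟨by positivity, hkm⟩
  have hspos := sinpBase_pos hp (Ioo_subset_Ioc_self hkmI)
  have hone := rpow_lt_one_of_mem_Ico hp ⟨hspos.le, sinpBase_lt_one hp (Ioo_subset_Ico_self hkmI)⟩
  rw [mul_comm (pip p / 2), cotp_eq hp hkmI, hkp1, mul_assoc, ← Real.mul_rpow hk0.le
    (div_nonneg (Real.rpow_nonneg hone.le _) hspos.le), ← mul_div_assoc]
  exact hsharp

theorem sharpLyapunov_lyapunovConst {p lam : ℝ} (hp : 1 < p) (hlam : lam < p - 1) :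
    SharpLyapunov p lam (lyapunovConst p lam) := by
  rw [lyapunovConst]
  split_ifs with h1 h2
  · exact sharpLyapunov_pos hp h1 hlam
  · subst h2; exact sharpLyapunov_zero hp
  · exact sharpLyapunov_neg hp (lt_of_le_of_ne (not_lt.1 h1) h2)

end

theorem theorem1 (p lam : ℝ) (hp : 1 < p) (hlam : lam < p - 1) :
    (∀ r : ℝ → ℝ, ContinuousOn r (Icc 0 (pip p)) → HasNontrivialSolution p lam r →
      lyapunovConst p lam < normPosPart p r) ∧
    (∀ ε : ℝ, 0 < ε → ∃ r : ℝ → ℝ, ContinuousOn r (Icc 0 (pip p)) ∧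
      HasNontrivialSolution p lam r ∧ |normPosPart p r - lyapunovConst p lam| < ε) :=
  sharpLyapunov_lyapunovConst hp hlam
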